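/- Let $C_1,C_2$ be real symmetric $3\times3$ matrices whose upper-left $2\times 2$ blocks are positive definite and whose determinants are negative, such that $C_1^{-1}C_2$ has three distinct positive eigenvalues $\lambda_1>\lambda_2>\lambda_3>0$, and such that $\mathbf u^TC_2\mathbf u=0$, $\mathbf u\ne 0$ implies $\mathbf u^TC_1\mathbf u<0$. For $\nu=(\nu_1,\nu_2)\in\mathbb R^2$ put $C_\nu=\nu_1C_1+\nu_2C_2$; write $\mathcal C_1$ and $\mathcal C_\nu$ for the conics $\{(x,y):\mathbf u^TC\mathbf u=0,\ \mathbf u=(x,y,1)^T\}$ with $C=C_1$ and $C=C_\nu$. Call $\nu$ valid if $\nu_2>0$ and $\nu_1+\lambda_3\nu_2>0$. Let $$e=\sqrt{\frac{\lambda_1-\lambda_2}{\lambda_1-\lambda_3}},\quad F(\phi,e)=\int_0^\phi\frac{d\tau}{\sqrt{1-e^2\sin^2\tau}},\quad K(e)=F(\tfrac\pi2,e),$$ $$\omega(\nu)=\arcsin\sqrt{\frac{(\lambda_1-\lambda_3)\nu_2}{\lambda_1\nu_2+\nu_1}},\qquad \rho(\nu)=\frac{F(\omega(\nu),e)}{2K(e)},$$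 and let $\mathrm{sn},\mathrm{cn}$ be the Jacobi elliptic functions. (0) For each valid $\nu$ the Poncelet map $P_\nu:\mathcal C_1\to\mathcal C_1$ is a well-defined homeomorphism, where $P_\nu(z)$ is the unique $w\in\mathcal C_1$ such that the oriented segment from $z$ to $w$ is tangent to $\mathcal C_\nu$ with $\mathcal C_\nu$ on its left. (1) There is a nonsingular $M=(m_{ij})$ with $M^TC_1M=\mathrm{diag}(1,1,-1)$, $M^TC_2M=\mathrm{diag}(\lambda_1,\lambda_2,-\lambda_3)$ and $\det(M)\,m_{33}>0$. For every such $M$, with $\widehat M$ its projective map of the plane, $$\Pi_M(\theta)=\widehat M\big(\mathrm{cn}(4K(e)\theta,e),\ \mathrm{sn}(4K(e)\theta,e)\big)$$ is a (surjective, counterclockwise) covering map $\Pi_M:\mathbb R\to\mathcal C_1$ with $\Pi_M(s)=\Pi_M(t)$ if and only if $s-t\in\mathbb Z$, and $P_\nu\circ\Pi_M(\theta)=\Pi_M(\theta+\rho(\nu))$ for all valid $\nu$ and all $\theta\in\mathbb R$. In particular $P_\nu\circ P_\mu$ has the lift $\theta\mapsto\theta+\rho(\mu)+\rho(\nu)$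 for all valid $\nu,\mu$. (2) $P_\nu\circ P_\mu=P_\mu\circ P_\nu$ for all valid $\nu,\mu$. (3) Let $\nu^1,\dots,\nu^N$ be valid, let $k_1,\dots,k_N\in\mathbb Z$, and let $P_*=(P_{\nu^N})^{k_N}\circ\cdots\circ(P_{\nu^1})^{k_1}$ and $\sigma=\sum_{j=1}^N k_j\,\rho(\nu^j)$. Then $\theta\mapsto\theta+\sigma$ is a lift of $P_*$ through every $\Pi_M$ as in (1), and $P_*$ has rotation number $\sigma$. Here the rotation number of a homeomorphism of $\mathcal C_1$ is the translation number $\lim_n G^n(x)/n$ of a continuous increasing lift $G$, with $G(x+1)=G(x)+1$, to a counterclockwise covering $\mathbb R\to\mathcal C_1$ of period $1$; it depends on the choice of lift only up to an integer, so the rotation numbers of $P_*$ are exactly the numbers $\sigma+m$, $m\in\mathbb Z$. Moreover the following are equivalent: $P_*=\mathrm{id}$; $\sigma\in\mathbb Z$; $P_*$ has a fixed point. -/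

import Mathlib

noncomputable section

namespace Poncelet

/-! ### Elliptic integrals and Jacobi elliptic functions (with modulus `e`) -/

/-- The incomplete elliptic integral of the first kind
`F(φ, e) = ∫₀^φ dτ / √(1 - e² sin² τ)`. -/
def ellF (φ e : ℝ) : ℝ := ∫ τ in (0 : ℝ)..φ, 1 / Real.sqrt (1 - e ^ 2 * Real.sin τ ^ 2)

/-- The complete elliptic integral of the first kind `K(e) = F(π/2, e)`. -/
def ellK (e : ℝ) : ℝ := ellF (Real.pi / 2) e

/-- The Jacobi amplitude `u ↦ am(u, e)`, the inverse function of `φ ↦ F(φ, e)`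
(which is an increasing bijection of `ℝ` when `0 ≤ e < 1`, see `ellF_bijective`). -/
def jacobiAm (u e : ℝ) : ℝ := Function.invFun (fun φ : ℝ => ellF φ e) u

/-- The Jacobi elliptic function `sn(u, e) = sin (am(u, e))`. -/
def jacobiSn (u e : ℝ) : ℝ := Real.sin (jacobiAm u e)

/-- The Jacobi elliptic function `cn(u, e) = cos (am(u, e))`. -/
def jacobiCn (u e : ℝ) : ℝ := Real.cos (jacobiAm u e)

/-- For `0 ≤ e < 1` the map `φ ↦ F(φ, e)` is a bijection, so that `jacobiAm` is its inverse. -/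
theorem ellF_bijective {e : ℝ} (he0 : 0 ≤ e) (he1 : e < 1) :
    Function.Bijective (fun φ : ℝ => ellF φ e) := by
  have hpos : ∀ τ : ℝ, 0 < 1 - e ^ 2 * Real.sin τ ^ 2 := by
    intro τ
    have h1 : Real.sin τ ^ 2 ≤ 1 := Real.sin_sq_le_one τ
    have h2 : e ^ 2 < 1 := by nlinarith
    nlinarith [sq_nonneg e, sq_nonneg (Real.sin τ)]
  have hcont : Continuous (fun τ : ℝ => 1 / Real.sqrt (1 - e ^ 2 * Real.sin τ ^ 2)) := by
    refine Continuous.div continuous_const (by fun_prop) ?_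
    intro τ
    exact (Real.sqrt_pos.2 (hpos τ)).ne'
  have hge : ∀ τ : ℝ, 1 ≤ 1 / Real.sqrt (1 - e ^ 2 * Real.sin τ ^ 2) := by
    intro τ
    rw [le_div_iff₀ (Real.sqrt_pos.2 (hpos τ)), one_mul]
    refine Real.sqrt_le_one.2 ?_
    nlinarith [mul_nonneg (sq_nonneg e) (sq_nonneg (Real.sin τ))]
  have hincr : ∀ a b : ℝ, a ≤ b → b - a ≤ ellF b e - ellF a e := by
    intro a b hab
    have h1 : ellF b e - ellF a e
        = ∫ τ in a..b, 1 / Real.sqrt (1 - e ^ 2 * Real.sin τ ^ 2) :=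
      intervalIntegral.integral_interval_sub_left (hcont.intervalIntegrable _ _)
        (hcont.intervalIntegrable _ _)
    have h2 : ∫ _τ in a..b, (1 : ℝ) ≤ ∫ τ in a..b, 1 / Real.sqrt (1 - e ^ 2 * Real.sin τ ^ 2) :=
      intervalIntegral.integral_mono_on hab (continuous_const.intervalIntegrable _ _)
        (hcont.intervalIntegrable _ _) (fun τ _ => hge τ)
    rw [h1]
    simpa using h2
  have h0 : ellF 0 e = 0 := by simp [ellF]
  refine ⟨?_, ?_⟩
  · have hm : StrictMono (fun φ : ℝ => ellF φ e) := by
      intro a b hab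
      have := hincr a b hab.le
      show ellF a e < ellF b e
      linarith
    exact hm.injective
  · have hc : Continuous (fun φ : ℝ => ellF φ e) :=
      intervalIntegral.continuous_primitive (fun a b => hcont.intervalIntegrable a b) 0
    refine hc.surjective ?_ ?_
    · refine Filter.tendsto_atTop_mono' _ ?_ Filter.tendsto_id
      filter_upwards [Filter.eventually_ge_atTop (0 : ℝ)] with x hx
      have := hincr 0 x hx
      simp only [id]
      linarith
    · refine Filter.tendsto_atBot_mono' _ ?_ Filter.tendsto_id
      filter_upwards [Filter.eventually_le_atBot (0 : ℝ)] with x hx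
      have := hincr x 0 hx
      simp only [id]
      linarith

/-! ### Conics, pencils, standing assumptions -/

/-- The quadratic form `uᵀ C u`. -/
def quad (C : Matrix (Fin 3) (Fin 3) ℝ) (u : Fin 3 → ℝ) : ℝ := u ⬝ᵥ (C.mulVec u)

/-- The conic `{(x, y) : uᵀ C u = 0, u = (x, y, 1)}` in the plane. -/
def conic (C : Matrix (Fin 3) (Fin 3) ℝ) : Set (ℝ × ℝ) :=
  {p | quad C ![p.1, p.2, 1] = 0}

/-- Ordered signature `(+,+,-)`: symmetric, upper-left `2 × 2` block positive definite, and
negative determinant. -/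
structure OrderedSignature (C : Matrix (Fin 3) (Fin 3) ℝ) : Prop where
  symm : C.IsSymm
  posDef : ∀ x y : ℝ, (x, y) ≠ (0, 0) → 0 < quad C ![x, y, 0]
  det_neg : C.det < 0

/-- The standing assumptions on a pair of matrices: both have ordered signature; `C₁⁻¹ C₂` has
the three positive distinct eigenvalues `l₁ > l₂ > l₃ > 0`; the second ellipse is inside the
first one. -/
structure StandingAssumptions (C₁ C₂ : Matrix (Fin 3) (Fin 3) ℝ) (l₁ l₂ l₃ : ℝ) : Prop where
  sig₁ : OrderedSignature C₁
  sig₂ : OrderedSignature C₂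
  eig₁ : Module.End.HasEigenvalue (Matrix.toLin' (C₁⁻¹ * C₂)) l₁
  eig₂ : Module.End.HasEigenvalue (Matrix.toLin' (C₁⁻¹ * C₂)) l₂
  eig₃ : Module.End.HasEigenvalue (Matrix.toLin' (C₁⁻¹ * C₂)) l₃
  lt₁₂ : l₂ < l₁
  lt₂₃ : l₃ < l₂
  pos₃ : 0 < l₃
  inside : ∀ u : Fin 3 → ℝ, u ≠ 0 → quad C₂ u = 0 → quad C₁ u < 0

/-- The member `ν₁ C₁ + ν₂ C₂` of the pencil. -/
def pencil (C₁ C₂ : Matrix (Fin 3) (Fin 3) ℝ) (ν : ℝ × ℝ) : Matrix (Fin 3) (Fin 3) ℝ :=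
  ν.1 • C₁ + ν.2 • C₂

/-- The cone of valid parameters: `ν₂ > 0` and `ν₁ + l₃ ν₂ > 0`. -/
def Valid (l₃ : ℝ) (ν : ℝ × ℝ) : Prop := 0 < ν.2 ∧ 0 < ν.1 + l₃ * ν.2

/-- The pencil eccentricity. -/
def eccentricity (l₁ l₂ l₃ : ℝ) : ℝ := Real.sqrt ((l₁ - l₂) / (l₁ - l₃))

/-- The angle `ω(ν)`. -/
def omega (l₁ l₃ : ℝ) (ν : ℝ × ℝ) : ℝ :=
  Real.arcsin (Real.sqrt ((l₁ - l₃) * ν.2 / (l₁ * ν.2 + ν.1)))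

/-- The number `ρ(ν) = F(ω(ν), e) / (2 K(e))`, with `e` the pencil eccentricity. -/
def rho (l₁ l₂ l₃ : ℝ) (ν : ℝ × ℝ) : ℝ :=
  ellF (omega l₁ l₃ ν) (eccentricity l₁ l₂ l₃) / (2 * ellK (eccentricity l₁ l₂ l₃))

/-! ### Poncelet maps -/

/-- The planar cross product `(b - a) × (c - a)`; it is positive when `c` lies strictly to the
left of the line from `a` to `b`. -/
def orient (a b c : ℝ × ℝ) : ℝ :=
  (b.1 - a.1) * (c.2 - a.2) - (b.2 - a.2) * (c.1 - a.1)

/-- The oriented segment from `z` to `w` is tangent to the (strictly convex) curve `Ci` with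
positive orientation: it touches `Ci` at a point `p`, and the rest of `Ci` lies strictly to the
left of the line from `z` to `w`. -/
def PositivelyTangent (Ci : Set (ℝ × ℝ)) (z w : ℝ × ℝ) : Prop :=
  ∃ p ∈ Ci, p ∈ segment ℝ z w ∧ ∀ q ∈ Ci, q ≠ p → 0 < orient z w q

/-- `P` is the Poncelet map of the outer curve `Co` and the inner curve `Ci`: for each `z` in
`Co`, `P z` is the unique point `w` of `Co` for which the segment from `z` to `w` is tangent to
`Ci` with positive orientation. -/
def IsPonceletMap (Co Ci : Set (ℝ × ℝ)) (P : Co ≃ₜ Co) : Prop :=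
  ∀ z w : Co, PositivelyTangent Ci z w ↔ w = P z

open Classical in
/-- The Poncelet map of `Co` and `Ci`, as a self-homeomorphism of `Co` (the identity, as a junk
value, when there is no Poncelet map). -/
def ponceletMap (Co Ci : Set (ℝ × ℝ)) : Co ≃ₜ Co :=
  if h : ∃ P : Co ≃ₜ Co, IsPonceletMap Co Ci P then h.choose else Homeomorph.refl Co

/-- The Poncelet map `P_ν` of the pencil, with outer ellipse `C₁` and inner ellipse `C_ν`. -/
def pencilMap (C₁ C₂ : Matrix (Fin 3) (Fin 3) ℝ) (ν : ℝ × ℝ) : conic C₁ ≃ₜ conic C₁ :=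
  ponceletMap (conic C₁) (conic (pencil C₁ C₂ ν))

/-- The composition `(P_{ν^N})^{k_N} ∘ ⋯ ∘ (P_{ν^1})^{k_1}`; the product in the group of
homeomorphisms is composition. -/
def pencilComposition (C₁ C₂ : Matrix (Fin 3) (Fin 3) ℝ) {N : ℕ} (ν : Fin N → ℝ × ℝ)
    (k : Fin N → ℤ) : conic C₁ ≃ₜ conic C₁ :=
  (List.ofFn fun j => pencilMap C₁ C₂ (ν j) ^ k j).reverse.prod

/-! ### Covering maps of convex curves and rotation numbers -/

/-- `c : ℝ → C` is a surjective covering map of the strictly convex curve `C` whose fibres are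
the orbits of `θ ↦ θ + 1`, and which runs counterclockwise around `C`. -/
structure IsPositiveCover {C : Set (ℝ × ℝ)} (c : ℝ → C) : Prop where
  isCoveringMap : IsCoveringMap c
  surjective : Function.Surjective c
  eq_iff : ∀ s t : ℝ, c s = c t ↔ ∃ m : ℤ, t = s + m
  counterclockwise : ∀ s t u : ℝ, s < t → t < u → u < s + 1 → 0 < orient (c s) (c t) (c u)

/-- The real number `r` is a rotation number of the circle map `P : C → C`: some (continuous,
monotone, degree one) lift `G : ℝ → ℝ` of `P` to a counterclockwise cover of `C` with period `1`
has translation number `lim Gⁿ(x) / n` equal to `r`. -/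
def HasRotationNumber {C : Set (ℝ × ℝ)} (P : C → C) (r : ℝ) : Prop :=
  ∃ c : ℝ → C, IsPositiveCover c ∧ ∃ G : CircleDeg1Lift, Continuous G ∧
    (∀ θ : ℝ, P (c θ) = c (G θ)) ∧ G.translationNumber = r

/-! ### The standard covering map -/

/-- `M` diagonalizes the pair `C₁`, `C₂` by congruence, and its projective map preserves
orientation. -/
structure IsDiagonalizer (C₁ C₂ : Matrix (Fin 3) (Fin 3) ℝ) (l₁ l₂ l₃ : ℝ)
    (M : Matrix (Fin 3) (Fin 3) ℝ) : Prop where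
  diag₁ : M.transpose * C₁ * M = Matrix.diagonal ![1, 1, -1]
  diag₂ : M.transpose * C₂ * M = Matrix.diagonal ![l₁, l₂, -l₃]
  orientation : 0 < M.det * M 2 2

/-- The projective map of the plane given by the matrix `M`. -/
def projMap (M : Matrix (Fin 3) (Fin 3) ℝ) (p : ℝ × ℝ) : ℝ × ℝ :=
  ((M 0 0 * p.1 + M 0 1 * p.2 + M 0 2) / (M 2 0 * p.1 + M 2 1 * p.2 + M 2 2),
   (M 1 0 * p.1 + M 1 1 * p.2 + M 1 2) / (M 2 0 * p.1 + M 2 1 * p.2 + M 2 2))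

/-- The standard covering map
`Π_M(θ) = M̂ (cn(4 K(e) θ, e), sn(4 K(e) θ, e))`, as a map into the plane. -/
def standardCover (M : Matrix (Fin 3) (Fin 3) ℝ) (e θ : ℝ) : ℝ × ℝ :=
  projMap M (jacobiCn (4 * ellK e * θ) e, jacobiSn (4 * ellK e * θ) e)

end Poncelet

end

noncomputable section

namespace Poncelet

/-! ### Elliptic integrals and Jacobi elliptic functions -/

/-! In the coordinates of a diagonalizer `M` the outer conic is the unit circle and `C_ν` is the
ellipse a x² + b y² = c with a = ν₁ + l₁ν₂, b = ν₁ + l₂ν₂, c = ν₁ + l₃ν₂. The ratio (a - b)/(a - c)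
= (l₁ - l₂)/(l₁ - l₃) = e² does not depend on ν, so the whole pencil shares one modulus. Parametrize
the circle by (cn u, sn u) with this modulus. By the addition formulas, the chord joining the
parameters u - w and u + w lies on the line cn u · x + dn w sn u · y = cn w (`orient_circlePoint`).
For fixed w these lines are all tangent to the ellipse x² + dn² w · y² = cn² w, which does not
depend on u. For w = F(ω(ν), e) this ellipse is `C_ν` (`omega_spec`), so the Poncelet map adds 2w to
u, that is, ρ(ν) to θ = u / (4K). Commutation and the closure criterion are then facts about
translations modulo 1.

The picture returns to the original plane through the projective map of `M`. Its denominator has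
constant sign on the closed unit disk, because the upper-left block of `C₁` is positive definite;
hence segments and the sign of `orient` are preserved there (`projMap_mem_segment`,
`orient_projMap_pos`). This gives existence of the tangent chord (`positivelyTangent`); uniqueness
is a half-plane argument (`positivelyTangent_unique`).

A diagonalizer exists because distinct eigenvalues give an orthogonal basis for both forms, and the
nesting of the conics decides which eigenvalue carries the negative sign (`not_neg_pos`). The
rotation number is independent of the cover because any two positive covers differ by a strictly
increasing degree one map (`exists_strictMono_lift`), which semiconjugates any other lift to a
translation. -/

theorem one_sub_sq_mul_sin_sq_pos {e : ℝ} (he0 : 0 ≤ e) (he1 : e < 1) (τ : ℝ) :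
    0 < 1 - e ^ 2 * Real.sin τ ^ 2 := by
  have h1 : Real.sin τ ^ 2 ≤ 1 := Real.sin_sq_le_one τ
  have h2 : e ^ 2 < 1 := by nlinarith
  nlinarith [sq_nonneg e, sq_nonneg (Real.sin τ)]

theorem continuous_ellF_integrand {e : ℝ} (he0 : 0 ≤ e) (he1 : e < 1) :
    Continuous (fun τ : ℝ => 1 / Real.sqrt (1 - e ^ 2 * Real.sin τ ^ 2)) := by
  refine Continuous.div continuous_const (by fun_prop) ?_
  intro τ
  exact (Real.sqrt_pos.2 (one_sub_sq_mul_sin_sq_pos he0 he1 τ)).ne'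

theorem hasDerivAt_ellF {e : ℝ} (he0 : 0 ≤ e) (he1 : e < 1) (φ : ℝ) :
    HasDerivAt (fun φ => ellF φ e) (1 / Real.sqrt (1 - e ^ 2 * Real.sin φ ^ 2)) φ :=
  intervalIntegral.integral_hasDerivAt_right
    ((continuous_ellF_integrand he0 he1).intervalIntegrable _ _)
    (continuous_ellF_integrand he0 he1).stronglyMeasurable.stronglyMeasurableAtFilter
    (continuous_ellF_integrand he0 he1).continuousAt

theorem strictMono_ellF {e : ℝ} (he0 : 0 ≤ e) (he1 : e < 1) : StrictMono (fun φ => ellF φ e) := by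
  refine strictMono_of_deriv_pos fun φ => ?_
  rw [(hasDerivAt_ellF he0 he1 φ).deriv]
  have := Real.sqrt_pos.2 (one_sub_sq_mul_sin_sq_pos he0 he1 φ)
  positivity

@[simp] theorem ellF_zero (e : ℝ) : ellF 0 e = 0 := by simp [ellF]

theorem ellF_neg (φ e : ℝ) : ellF (-φ) e = -ellF φ e := by
  have h := intervalIntegral.integral_comp_neg (a := 0) (b := φ)
    (fun τ => 1 / Real.sqrt (1 - e ^ 2 * Real.sin τ ^ 2))
  simp only [Real.sin_neg, neg_sq, neg_zero] at h
  unfold ellF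
  rw [h, intervalIntegral.integral_symm]

theorem ellF_add_pi {e : ℝ} (he0 : 0 ≤ e) (he1 : e < 1) (φ : ℝ) :
    ellF (φ + Real.pi) e = ellF φ e + 2 * ellK e := by
  have hc := continuous_ellF_integrand he0 he1
  have hper : Function.Periodic
      (fun τ : ℝ => 1 / Real.sqrt (1 - e ^ 2 * Real.sin τ ^ 2)) Real.pi := by
    intro τ
    simp [Real.sin_add_pi]
  have h1 : ∀ a b : ℝ, ellF b e - ellF a e
      = ∫ τ in a..b, 1 / Real.sqrt (1 - e ^ 2 * Real.sin τ ^ 2) := fun a b =>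
    intervalIntegral.integral_interval_sub_left (hc.intervalIntegrable _ _)
      (hc.intervalIntegrable _ _)
  -- Periodicity moves the window to [-π/2, π/2], where oddness of F gives 2K.
  have h2 := hper.intervalIntegral_add_eq φ (-(Real.pi / 2))
  rw [← h1, ← h1, ellF_neg, show -(Real.pi / 2) + Real.pi = Real.pi / 2 by ring] at h2
  unfold ellK
  linarith

theorem ellK_pos {e : ℝ} (he0 : 0 ≤ e) (he1 : e < 1) : 0 < ellK e := by
  have := strictMono_ellF he0 he1 (show (0 : ℝ) < Real.pi / 2 by positivity)
  simpa [ellK] using this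

theorem jacobiAm_ellF {e : ℝ} (he0 : 0 ≤ e) (he1 : e < 1) (φ : ℝ) :
    jacobiAm (ellF φ e) e = φ :=
  Function.leftInverse_invFun (ellF_bijective he0 he1).1 φ

theorem ellF_jacobiAm {e : ℝ} (he0 : 0 ≤ e) (he1 : e < 1) (u : ℝ) :
    ellF (jacobiAm u e) e = u :=
  Function.rightInverse_invFun (ellF_bijective he0 he1).2 u

theorem strictMono_jacobiAm {e : ℝ} (he0 : 0 ≤ e) (he1 : e < 1) :
    StrictMono (fun u => jacobiAm u e) := by
  intro u v huv
  rw [← ellF_jacobiAm he0 he1 u, ← ellF_jacobiAm he0 he1 v] at huv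
  exact (strictMono_ellF he0 he1).lt_iff_lt.1 huv

theorem surjective_jacobiAm {e : ℝ} (he0 : 0 ≤ e) (he1 : e < 1) :
    Function.Surjective (fun u => jacobiAm u e) :=
  fun φ => ⟨ellF φ e, jacobiAm_ellF he0 he1 φ⟩

/-- A monotone surjection of ℝ has no jumps. Continuity is needed first, as input to the inverse
function rule in `hasDerivAt_jacobiAm`. -/
theorem continuous_jacobiAm {e : ℝ} (he0 : 0 ≤ e) (he1 : e < 1) :
    Continuous (fun u => jacobiAm u e) :=
  (strictMono_jacobiAm he0 he1).monotone.continuous_of_surjective (surjective_jacobiAm he0 he1)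

theorem jacobiAm_zero {e : ℝ} (he0 : 0 ≤ e) (he1 : e < 1) : jacobiAm 0 e = 0 := by
  simpa using jacobiAm_ellF he0 he1 0

theorem jacobiAm_neg {e : ℝ} (he0 : 0 ≤ e) (he1 : e < 1) (u : ℝ) :
    jacobiAm (-u) e = -jacobiAm u e := by
  conv_lhs => rw [← ellF_jacobiAm he0 he1 u, ← ellF_neg, jacobiAm_ellF he0 he1]

theorem jacobiAm_add_four_ellK {e : ℝ} (he0 : 0 ≤ e) (he1 : e < 1) (u : ℝ) :
    jacobiAm (u + 4 * ellK e) e = jacobiAm u e + 2 * Real.pi := by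
  conv_lhs => rw [← ellF_jacobiAm he0 he1 u]
  have h : ellF (jacobiAm u e + Real.pi + Real.pi) e =
      ellF (jacobiAm u e) e + 2 * ellK e + 2 * ellK e := by
    rw [ellF_add_pi he0 he1, ellF_add_pi he0 he1]
  rw [show ellF (jacobiAm u e) e + 4 * ellK e = ellF (jacobiAm u e + Real.pi + Real.pi) e by
    rw [h]; ring, jacobiAm_ellF he0 he1]
  ring

/-- The Jacobi elliptic function `dn(u, e) = √(1 - e² sn² u)`. -/
def jacobiDn (u e : ℝ) : ℝ := Real.sqrt (1 - e ^ 2 * jacobiSn u e ^ 2)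

theorem jacobiDn_pos {e : ℝ} (he0 : 0 ≤ e) (he1 : e < 1) (u : ℝ) : 0 < jacobiDn u e :=
  Real.sqrt_pos.2 (one_sub_sq_mul_sin_sq_pos he0 he1 _)

theorem jacobiDn_sq {e : ℝ} (he0 : 0 ≤ e) (he1 : e < 1) (u : ℝ) :
    jacobiDn u e ^ 2 = 1 - e ^ 2 * jacobiSn u e ^ 2 :=
  Real.sq_sqrt (one_sub_sq_mul_sin_sq_pos he0 he1 _).le

theorem jacobiCn_sq (u e : ℝ) : jacobiCn u e ^ 2 = 1 - jacobiSn u e ^ 2 :=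
  Real.cos_sq' _

theorem jacobiSn_sq_le_one (u e : ℝ) : jacobiSn u e ^ 2 ≤ 1 := Real.sin_sq_le_one _

theorem jacobiSn_zero {e : ℝ} (he0 : 0 ≤ e) (he1 : e < 1) : jacobiSn 0 e = 0 := by
  simp [jacobiSn, jacobiAm_zero he0 he1]

theorem jacobiCn_zero {e : ℝ} (he0 : 0 ≤ e) (he1 : e < 1) : jacobiCn 0 e = 1 := by
  simp [jacobiCn, jacobiAm_zero he0 he1]

theorem jacobiDn_zero {e : ℝ} (he0 : 0 ≤ e) (he1 : e < 1) : jacobiDn 0 e = 1 := by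
  simp [jacobiDn, jacobiSn_zero he0 he1]

theorem jacobiSn_neg {e : ℝ} (he0 : 0 ≤ e) (he1 : e < 1) (u : ℝ) :
    jacobiSn (-u) e = -jacobiSn u e := by
  simp [jacobiSn, jacobiAm_neg he0 he1]

theorem jacobiCn_neg {e : ℝ} (he0 : 0 ≤ e) (he1 : e < 1) (u : ℝ) :
    jacobiCn (-u) e = jacobiCn u e := by
  simp [jacobiCn, jacobiAm_neg he0 he1]

theorem jacobiDn_neg {e : ℝ} (he0 : 0 ≤ e) (he1 : e < 1) (u : ℝ) :
    jacobiDn (-u) e = jacobiDn u e := by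
  simp [jacobiDn, jacobiSn_neg he0 he1]

/-! ### Derivatives and addition formulas of the Jacobi functions -/

theorem hasDerivAt_jacobiAm {e : ℝ} (he0 : 0 ≤ e) (he1 : e < 1) (u : ℝ) :
    HasDerivAt (fun u => jacobiAm u e) (jacobiDn u e) u := by
  have h := HasDerivAt.of_local_left_inverse (continuous_jacobiAm he0 he1).continuousAt
    (hasDerivAt_ellF he0 he1 (jacobiAm u e))
    (one_div_ne_zero (Real.sqrt_pos.2 (one_sub_sq_mul_sin_sq_pos he0 he1 _)).ne')
    (Filter.Eventually.of_forall fun v => ellF_jacobiAm he0 he1 v)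
  rw [one_div, inv_inv] at h
  exact h

theorem hasDerivAt_jacobiSn {e : ℝ} (he0 : 0 ≤ e) (he1 : e < 1) (u : ℝ) :
    HasDerivAt (fun u => jacobiSn u e) (jacobiCn u e * jacobiDn u e) u :=
  (hasDerivAt_jacobiAm he0 he1 u).sin

theorem hasDerivAt_jacobiCn {e : ℝ} (he0 : 0 ≤ e) (he1 : e < 1) (u : ℝ) :
    HasDerivAt (fun u => jacobiCn u e) (-jacobiSn u e * jacobiDn u e) u :=
  (hasDerivAt_jacobiAm he0 he1 u).cos

theorem hasDerivAt_jacobiDn {e : ℝ} (he0 : 0 ≤ e) (he1 : e < 1) (u : ℝ) :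
    HasDerivAt (fun u => jacobiDn u e) (-(e ^ 2 * jacobiSn u e * jacobiCn u e)) u := by
  have hne : (1 - e ^ 2 * jacobiSn u e ^ 2) ≠ 0 := (one_sub_sq_mul_sin_sq_pos he0 he1 _).ne'
  have h := ((((hasDerivAt_jacobiSn he0 he1 u).pow 2).const_mul (e ^ 2)).const_sub 1).sqrt hne
  refine h.congr_deriv ?_
  have hd := (jacobiDn_pos he0 he1 u).ne'
  change _ / (2 * jacobiDn u e) = _
  field_simp
  push_cast
  ring

/-- The denominator of the addition formulas for the Jacobi elliptic functions is positive. -/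
theorem addition_denominator_pos {e : ℝ} (he0 : 0 ≤ e) (he1 : e < 1) (u v : ℝ) :
    0 < 1 - e ^ 2 * jacobiSn u e ^ 2 * jacobiSn v e ^ 2 := by
  have h1 := jacobiSn_sq_le_one u e
  have h2 : 0 < 1 - e ^ 2 * jacobiSn v e ^ 2 := one_sub_sq_mul_sin_sq_pos he0 he1 _
  nlinarith [mul_nonneg (sq_nonneg (e * jacobiSn v e)) (sub_nonneg.2 h1)]

theorem hasDerivAt_addition_denominator {e : ℝ} (he0 : 0 ≤ e) (he1 : e < 1) (c u : ℝ) :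
    HasDerivAt (fun u => 1 - e ^ 2 * jacobiSn u e ^ 2 * jacobiSn (c - u) e ^ 2)
      (-(2 * e ^ 2 * jacobiSn u e * jacobiSn (c - u) e *
        (jacobiCn u e * jacobiDn u e * jacobiSn (c - u) e
          - jacobiSn u e * (jacobiCn (c - u) e * jacobiDn (c - u) e)))) u := by
  have h2 := (hasDerivAt_jacobiSn he0 he1 (c - u)).comp_const_sub c u
  refine ((((hasDerivAt_jacobiSn he0 he1 u).pow 2).const_mul (e ^ 2)).mul
    (h2.pow 2) |>.const_sub 1).congr_deriv ?_
  simp only [Pi.pow_apply]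
  push_cast
  ring

/-- With c = u + v held fixed, the right-hand side is a function of u alone whose derivative
vanishes; its value at u = 0 is sn c. The formula for cn is obtained in the same way. -/
theorem jacobiSn_add {e : ℝ} (he0 : 0 ≤ e) (he1 : e < 1) (u v : ℝ) :
    jacobiSn (u + v) e =
      (jacobiSn u e * (jacobiCn v e * jacobiDn v e) + jacobiSn v e * (jacobiCn u e * jacobiDn u e))
        / (1 - e ^ 2 * jacobiSn u e ^ 2 * jacobiSn v e ^ 2) := by
  set c := u + v with hc
  have key : ∀ x : ℝ, HasDerivAt (fun u =>
      (jacobiSn u e * (jacobiCn (c - u) e * jacobiDn (c - u) e)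
        + jacobiSn (c - u) e * (jacobiCn u e * jacobiDn u e))
        / (1 - e ^ 2 * jacobiSn u e ^ 2 * jacobiSn (c - u) e ^ 2)) 0 x := by
    intro x
    have hs := hasDerivAt_jacobiSn he0 he1 x
    have hcn := hasDerivAt_jacobiCn he0 he1 x
    have hd := hasDerivAt_jacobiDn he0 he1 x
    have hs' := (hasDerivAt_jacobiSn he0 he1 (c - x)).comp_const_sub c x
    have hcn' := (hasDerivAt_jacobiCn he0 he1 (c - x)).comp_const_sub c x
    have hd' := (hasDerivAt_jacobiDn he0 he1 (c - x)).comp_const_sub c x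
    refine (((hs.mul (hcn'.mul hd')).add (hs'.mul (hcn.mul hd))).div
      (hasDerivAt_addition_denominator he0 he1 c x)
      (addition_denominator_pos he0 he1 x (c - x)).ne').congr_deriv ?_
    have c1 := jacobiCn_sq x e
    have c2 := jacobiCn_sq (c - x) e
    have d1 := jacobiDn_sq he0 he1 x
    have d2 := jacobiDn_sq he0 he1 (c - x)
    simp only [Pi.mul_apply, Pi.add_apply]
    rw [div_eq_zero_iff]
    left
    generalize jacobiSn x e = s₁ at *
    generalize jacobiCn x e = c₁ at *
    generalize jacobiDn x e = d₁ at *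
    generalize jacobiSn (c - x) e = s₂ at *
    generalize jacobiCn (c - x) e = c₂ at *
    generalize jacobiDn (c - x) e = d₂ at *
    have q1 : c₁ ^ 2 * d₁ ^ 2 = (1 - s₁ ^ 2) * (1 - e ^ 2 * s₁ ^ 2) := by rw [c1, d1]
    have q2 : c₂ ^ 2 * d₂ ^ 2 = (1 - s₂ ^ 2) * (1 - e ^ 2 * s₂ ^ 2) := by rw [c2, d2]
    -- The mixed terms c₁d₁c₂d₂ cancel in the derivative of the numerator, leaving s₁s₂(d₂² + e²c₂²
    -- - d₁² - e²c₁²). The other half of the quotient rule involves only c₁²d₁² and c₂²d₂², which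
    -- `q1` and `q2` turn into polynomials in s₁, s₂.
    linear_combination
      (1 - e ^ 2 * s₁ ^ 2 * s₂ ^ 2) * (s₁ * s₂) * (d2 + e ^ 2 * c2 - d1 - e ^ 2 * c1)
        + 2 * e ^ 2 * s₁ * s₂ * (s₂ ^ 2 * q1 - s₁ ^ 2 * q2)
  have hconst := is_const_of_deriv_eq_zero (fun x => (key x).differentiableAt)
    (fun x => (key x).deriv) u 0
  simp only [sub_zero, jacobiSn_zero he0 he1, jacobiCn_zero he0 he1,
    jacobiDn_zero he0 he1] at hconst
  rw [show c - u = v by rw [hc]; ring] at hconst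
  rw [hconst]
  simp

theorem jacobiCn_add {e : ℝ} (he0 : 0 ≤ e) (he1 : e < 1) (u v : ℝ) :
    jacobiCn (u + v) e =
      (jacobiCn u e * jacobiCn v e - jacobiSn u e * jacobiSn v e * (jacobiDn u e * jacobiDn v e))
        / (1 - e ^ 2 * jacobiSn u e ^ 2 * jacobiSn v e ^ 2) := by
  set c := u + v with hc
  have key : ∀ x : ℝ, HasDerivAt (fun u =>
      (jacobiCn u e * jacobiCn (c - u) e
        - jacobiSn u e * jacobiSn (c - u) e * (jacobiDn u e * jacobiDn (c - u) e))
        / (1 - e ^ 2 * jacobiSn u e ^ 2 * jacobiSn (c - u) e ^ 2)) 0 x := by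
    intro x
    have hs := hasDerivAt_jacobiSn he0 he1 x
    have hcn := hasDerivAt_jacobiCn he0 he1 x
    have hd := hasDerivAt_jacobiDn he0 he1 x
    have hs' := (hasDerivAt_jacobiSn he0 he1 (c - x)).comp_const_sub c x
    have hcn' := (hasDerivAt_jacobiCn he0 he1 (c - x)).comp_const_sub c x
    have hd' := (hasDerivAt_jacobiDn he0 he1 (c - x)).comp_const_sub c x
    refine (((hcn.mul hcn').sub ((hs.mul hs').mul (hd.mul hd'))).div
      (hasDerivAt_addition_denominator he0 he1 c x)
      (addition_denominator_pos he0 he1 x (c - x)).ne').congr_deriv ?_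
    have c1 := jacobiCn_sq x e
    have c2 := jacobiCn_sq (c - x) e
    have d1 := jacobiDn_sq he0 he1 x
    have d2 := jacobiDn_sq he0 he1 (c - x)
    simp only [Pi.mul_apply, Pi.sub_apply]
    rw [div_eq_zero_iff]
    left
    generalize jacobiSn x e = s₁ at *
    generalize jacobiCn x e = c₁ at *
    generalize jacobiDn x e = d₁ at *
    generalize jacobiSn (c - x) e = s₂ at *
    generalize jacobiCn (c - x) e = c₂ at *
    generalize jacobiDn (c - x) e = d₂ at *
    linear_combination
      (1 - e ^ 2 * s₁ ^ 2 * s₂ ^ 2) * (c₂ * d₁ * s₁ * d2 - c₁ * d₂ * s₂ * d1)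
        + 2 * e ^ 2 * s₁ * s₂ * (c₂ * d₁ * s₂ * (c1 + s₁ ^ 2 * d2)
          - c₁ * s₁ * d₂ * (c2 + s₂ ^ 2 * d1))
  have hconst := is_const_of_deriv_eq_zero (fun x => (key x).differentiableAt)
    (fun x => (key x).deriv) u 0
  simp only [sub_zero, jacobiSn_zero he0 he1, jacobiCn_zero he0 he1,
    jacobiDn_zero he0 he1] at hconst
  rw [show c - u = v by rw [hc]; ring] at hconst
  rw [hconst]
  simp

/-! ### Tangent chords of the unit circle -/

/-- The point of the unit circle with elliptic parameter `u`. -/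
def circlePoint (e u : ℝ) : ℝ × ℝ := (jacobiCn u e, jacobiSn u e)

theorem circlePoint_mem (e u : ℝ) : (circlePoint e u).1 ^ 2 + (circlePoint e u).2 ^ 2 = 1 :=
  Real.cos_sq_add_sin_sq _

/-- The point where the chord from `circlePoint e (u - w)` to `circlePoint e (u + w)` touches
its envelope. -/
def tangencyPoint (e u w : ℝ) : ℝ × ℝ :=
  (jacobiCn w e * jacobiCn u e, jacobiCn w e / jacobiDn w e * jacobiSn u e)

theorem circlePoint_add {e : ℝ} (he0 : 0 ≤ e) (he1 : e < 1) (u w : ℝ) :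
    circlePoint e (u + w) =
      ((jacobiCn u e * jacobiCn w e - jacobiSn u e * jacobiSn w e * (jacobiDn u e * jacobiDn w e))
        / (1 - e ^ 2 * jacobiSn u e ^ 2 * jacobiSn w e ^ 2),
      (jacobiSn u e * (jacobiCn w e * jacobiDn w e) + jacobiSn w e * (jacobiCn u e * jacobiDn u e))
        / (1 - e ^ 2 * jacobiSn u e ^ 2 * jacobiSn w e ^ 2)) := by
  rw [circlePoint, jacobiCn_add he0 he1, jacobiSn_add he0 he1]

theorem circlePoint_sub {e : ℝ} (he0 : 0 ≤ e) (he1 : e < 1) (u w : ℝ) :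
    circlePoint e (u - w) =
      ((jacobiCn u e * jacobiCn w e + jacobiSn u e * jacobiSn w e * (jacobiDn u e * jacobiDn w e))
        / (1 - e ^ 2 * jacobiSn u e ^ 2 * jacobiSn w e ^ 2),
      (jacobiSn u e * (jacobiCn w e * jacobiDn w e) - jacobiSn w e * (jacobiCn u e * jacobiDn u e))
        / (1 - e ^ 2 * jacobiSn u e ^ 2 * jacobiSn w e ^ 2)) := by
  rw [sub_eq_add_neg, circlePoint_add he0 he1, jacobiSn_neg he0 he1, jacobiCn_neg he0 he1,
    jacobiDn_neg he0 he1]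
  simp only [neg_sq]
  congr 2 <;> ring

/-- The last factor is the equation of the chord, the first a normalization whose sign is that of sn
w. The chord's equation is linear in (cn u, sn u), which is what makes its envelope an ellipse. -/
theorem orient_circlePoint {e : ℝ} (he0 : 0 ≤ e) (he1 : e < 1) (u w : ℝ) (q : ℝ × ℝ) :
    orient (circlePoint e (u - w)) (circlePoint e (u + w)) q =
      2 * jacobiSn w e * jacobiDn u e / (1 - e ^ 2 * jacobiSn u e ^ 2 * jacobiSn w e ^ 2) *
        (jacobiCn w e - (jacobiCn u e * q.1 + jacobiDn w e * jacobiSn u e * q.2)) := by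
  have hD := (addition_denominator_pos he0 he1 u w).ne'
  have c1 := jacobiCn_sq u e
  have d2 := jacobiDn_sq he0 he1 w
  rw [circlePoint_add he0 he1, circlePoint_sub he0 he1, orient]
  generalize hDD : 1 - e ^ 2 * jacobiSn u e ^ 2 * jacobiSn w e ^ 2 = D at *
  generalize jacobiSn u e = s₁ at *
  generalize jacobiCn u e = c₁ at *
  generalize jacobiDn u e = d₁ at *
  generalize jacobiSn w e = s₂ at *
  generalize jacobiCn w e = c₂ at *
  generalize jacobiDn w e = d₂ at *
  field_simp
  linear_combination 2 * s₂ * d₁ * c₂ * (c1 + s₁ ^ 2 * d2 + hDD)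

theorem tangencyPoint_mem_chord {e : ℝ} (he0 : 0 ≤ e) (he1 : e < 1) (u w : ℝ) :
    ∃ t : ℝ, 0 ≤ t ∧ t ≤ 1 ∧
      (tangencyPoint e u w).1
        = (1 - t) * (circlePoint e (u - w)).1 + t * (circlePoint e (u + w)).1 ∧
      (tangencyPoint e u w).2
        = (1 - t) * (circlePoint e (u - w)).2 + t * (circlePoint e (u + w)).2 := by
  have hD := (addition_denominator_pos he0 he1 u w).ne'
  have c1 := jacobiCn_sq u e
  have d1 := jacobiDn_sq he0 he1 u
  have c2 := jacobiCn_sq w e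
  have d2 := jacobiDn_sq he0 he1 w
  have p1 := jacobiDn_pos he0 he1 u
  have p2 := jacobiDn_pos he0 he1 w
  rw [circlePoint_add he0 he1, circlePoint_sub he0 he1, tangencyPoint]
  generalize hDD : 1 - e ^ 2 * jacobiSn u e ^ 2 * jacobiSn w e ^ 2 = D at *
  generalize jacobiSn u e = s₁ at *
  generalize jacobiCn u e = c₁ at *
  generalize jacobiDn u e = d₁ at *
  generalize jacobiSn w e = s₂ at *
  generalize jacobiCn w e = c₂ at *
  generalize jacobiDn w e = d₂ at *
  -- Indeed d² - (e s c)² = (1 - e²) + e²(1 - s²)².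
  have bound : ∀ s c d : ℝ, c ^ 2 = 1 - s ^ 2 → d ^ 2 = 1 - e ^ 2 * s ^ 2 → 0 < d →
      |e * s * c| ≤ d := by
    intro s c d hc hd hp
    refine abs_le_of_sq_le_sq ?_ hp.le
    have he : e ^ 2 ≤ 1 := by nlinarith
    have : (e * s * c) ^ 2 = e ^ 2 * (s ^ 2 * (1 - s ^ 2)) := by rw [← hc]; ring
    rw [this, hd]
    nlinarith [sq_nonneg (1 - s ^ 2), mul_le_mul_of_nonneg_right he (sq_nonneg (1 - s ^ 2))]
  have hb : |e * s₁ * c₁ * (e * s₂ * c₂)| ≤ d₁ * d₂ := by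
    rw [abs_mul]
    exact mul_le_mul (bound _ _ _ c1 d1 p1) (bound _ _ _ c2 d2 p2) (abs_nonneg _) p1.le
  obtain ⟨hb1, hb2⟩ := abs_le.1 hb
  have hp : 0 < d₁ * d₂ := mul_pos p1 p2
  -- This weight comes from solving the affine relation for t; the product bound `hb` says exactly
  -- that it lies in [0, 1].
  refine ⟨1 / 2 * (1 + e * s₁ * c₁ * (e * s₂ * c₂) / (d₁ * d₂)), ?_, ?_, ?_, ?_⟩
  · have : -1 ≤ e * s₁ * c₁ * (e * s₂ * c₂) / (d₁ * d₂) := by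
      rw [le_div_iff₀ hp]; linarith
    linarith
  · have : e * s₁ * c₁ * (e * s₂ * c₂) / (d₁ * d₂) ≤ 1 := by
      rw [div_le_iff₀ hp]; linarith
    linarith
  · field_simp
    subst hDD
    ring
  · field_simp
    subst hDD
    linear_combination -2 * c₂ * s₁ * d₁ * (d2 + e ^ 2 * s₂ ^ 2 * c1)

/-- Cauchy–Schwarz: (q.1, dn w · q.2) has length cn w, so its inner product with the unit vector (cn
u, sn u) is at most cn w, with equality only when the two are parallel, which is the tangency point.
-/
theorem orient_tangent_pos {e : ℝ} (he0 : 0 ≤ e) (he1 : e < 1) (u : ℝ) {w : ℝ}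
    (hs : 0 < jacobiSn w e) (hc : 0 < jacobiCn w e) {q : ℝ × ℝ}
    (hq : q.1 ^ 2 + jacobiDn w e ^ 2 * q.2 ^ 2 = jacobiCn w e ^ 2)
    (hne : q ≠ tangencyPoint e u w) :
    0 < orient (circlePoint e (u - w)) (circlePoint e (u + w)) q := by
  rw [orient_circlePoint he0 he1]
  have hD := addition_denominator_pos he0 he1 u w
  have hd := jacobiDn_pos he0 he1 u
  have hd' := jacobiDn_pos he0 he1 w
  refine mul_pos (by positivity) ?_
  have c1 := jacobiCn_sq u e
  by_contra hle
  rw [not_lt] at hle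
  apply hne
  have hsq : (q.1 - jacobiCn w e * jacobiCn u e) ^ 2
      + (jacobiDn w e * q.2 - jacobiCn w e * jacobiSn u e) ^ 2 ≤ 0 := by
    nlinarith [mul_le_mul_of_nonneg_left hle hc.le]
  have h1 : q.1 - jacobiCn w e * jacobiCn u e = 0 := by
    nlinarith [sq_nonneg (q.1 - jacobiCn w e * jacobiCn u e),
      sq_nonneg (jacobiDn w e * q.2 - jacobiCn w e * jacobiSn u e)]
  have h2 : jacobiDn w e * q.2 - jacobiCn w e * jacobiSn u e = 0 := by
    nlinarith [sq_nonneg (q.1 - jacobiCn w e * jacobiCn u e),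
      sq_nonneg (jacobiDn w e * q.2 - jacobiCn w e * jacobiSn u e)]
  ext
  · simp only [tangencyPoint]; linarith
  · simp only [tangencyPoint]; field_simp; linarith

theorem orient_circle {a b c : ℝ} (hab : a < b) (hbc : b < c) (hca : c < a + 2 * Real.pi) :
    0 < orient (Real.cos a, Real.sin a) (Real.cos b, Real.sin b) (Real.cos c, Real.sin c) := by
  -- Twice the signed area of an inscribed triangle as a product of sines of half arcs; each half
  -- arc lies in (0, π).
  have key : orient (Real.cos a, Real.sin a) (Real.cos b, Real.sin b) (Real.cos c, Real.sin c)
      = 4 * Real.sin ((b - a) / 2) * Real.sin ((c - b) / 2) * Real.sin ((c - a) / 2) := by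
    obtain ⟨x, rfl⟩ : ∃ x, b = a + 2 * x := ⟨(b - a) / 2, by ring⟩
    obtain ⟨y, rfl⟩ : ∃ y, c = a + 2 * x + 2 * y := ⟨(c - (a + 2 * x)) / 2, by ring⟩
    rw [show (a + 2 * x - a) / 2 = x by ring,
      show (a + 2 * x + 2 * y - (a + 2 * x)) / 2 = y by ring,
      show (a + 2 * x + 2 * y - a) / 2 = x + y by ring]
    simp only [orient, Real.cos_add, Real.sin_add, Real.cos_two_mul', Real.sin_two_mul]
    have ha := Real.sin_sq_add_cos_sq a
    have hx := Real.sin_sq_add_cos_sq x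
    have hy := Real.sin_sq_add_cos_sq y
    generalize Real.sin a = sa at *
    generalize Real.cos a = ca at *
    generalize Real.sin x = sx at *
    generalize Real.cos x = cx at *
    generalize Real.sin y = sy at *
    generalize Real.cos y = cy at *
    grind
  rw [key]
  have h1 := Real.sin_pos_of_pos_of_lt_pi (x := (b - a) / 2) (by linarith) (by linarith)
  have h2 := Real.sin_pos_of_pos_of_lt_pi (x := (c - b) / 2) (by linarith) (by linarith)
  have h3 := Real.sin_pos_of_pos_of_lt_pi (x := (c - a) / 2) (by linarith) (by linarith)
  positivity

/-! ### Quadratic forms and the projective map of a congruence -/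

theorem quad_congr (C M : Matrix (Fin 3) (Fin 3) ℝ) (v : Fin 3 → ℝ) :
    quad C (M.mulVec v) = quad (M.transpose * C * M) v := by
  simp only [quad]
  rw [Matrix.mul_assoc, ← Matrix.mulVec_mulVec, ← Matrix.mulVec_mulVec,
    Matrix.dotProduct_mulVec v, Matrix.vecMul_transpose]

theorem quad_diagonal (a b c : ℝ) (v : Fin 3 → ℝ) :
    quad (Matrix.diagonal ![a, b, c]) v = a * v 0 ^ 2 + b * v 1 ^ 2 + c * v 2 ^ 2 := by
  simp [quad, dotProduct, Matrix.mulVec_diagonal, Fin.sum_univ_three]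
  ring

theorem quad_smul (C : Matrix (Fin 3) (Fin 3) ℝ) (r : ℝ) (v : Fin 3 → ℝ) :
    quad C (r • v) = r ^ 2 * quad C v := by
  simp only [quad, Matrix.mulVec_smul, smul_dotProduct, dotProduct_smul, smul_eq_mul]
  ring

/-- The form is positive definite on the line at infinity v 2 = 0, so the conic and its interior
stay in the affine plane. -/
theorem OrderedSignature.apply_two_ne_zero {C : Matrix (Fin 3) (Fin 3) ℝ} (hC : OrderedSignature C)
    {v : Fin 3 → ℝ} (hv : v ≠ 0) (hq : quad C v ≤ 0) : v 2 ≠ 0 := by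
  intro h2
  have hv' : v = ![v 0, v 1, 0] := by
    ext i; fin_cases i <;> simp [h2]
  have hne : (v 0, v 1) ≠ ((0 : ℝ), (0 : ℝ)) := by
    intro h
    rw [Prod.mk.injEq] at h
    apply hv
    rw [hv', h.1, h.2]
    ext i; fin_cases i <;> simp
  have := hC.posDef _ _ hne
  rw [← hv'] at this
  linarith

/-- The denominator of the projective map of `M`. -/
def projDenom (M : Matrix (Fin 3) (Fin 3) ℝ) (p : ℝ × ℝ) : ℝ :=
  M 2 0 * p.1 + M 2 1 * p.2 + M 2 2

theorem mulVec_eq_smul_projMap {M : Matrix (Fin 3) (Fin 3) ℝ} {p : ℝ × ℝ}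
    (hp : projDenom M p ≠ 0) :
    M.mulVec ![p.1, p.2, 1] = projDenom M p • ![(projMap M p).1, (projMap M p).2, 1] := by
  have h : projDenom M p = M 2 0 * p.1 + M 2 1 * p.2 + M 2 2 := rfl
  ext i
  fin_cases i <;>
    simp only [projMap, ← h, Matrix.mulVec, dotProduct, Fin.sum_univ_three, Pi.smul_apply,
      smul_eq_mul, Fin.zero_eta, Fin.mk_one, Fin.reduceFinMk, Matrix.cons_val]
  · field_simp
  · field_simp
  · rw [h]; ring

theorem quad_projMap {C M : Matrix (Fin 3) (Fin 3) ℝ} {p : ℝ × ℝ} (hp : projDenom M p ≠ 0) :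
    quad (M.transpose * C * M) ![p.1, p.2, 1]
      = projDenom M p ^ 2 * quad C ![(projMap M p).1, (projMap M p).2, 1] := by
  rw [← quad_congr, mulVec_eq_smul_projMap hp, quad_smul]

/-- `orient` is the 3 × 3 determinant of the homogeneous vectors (x, y, 1), and each image vector is
rescaled by its own denominator. -/
theorem orient_projMap {M : Matrix (Fin 3) (Fin 3) ℝ} {a b c : ℝ × ℝ}
    (ha : projDenom M a ≠ 0) (hb : projDenom M b ≠ 0) (hc : projDenom M c ≠ 0) :
    orient (projMap M a) (projMap M b) (projMap M c)
      = M.det * orient a b c / (projDenom M a * projDenom M b * projDenom M c) := by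
  rw [eq_div_iff (by positivity)]
  have h : ∀ p : ℝ × ℝ, M 2 0 * p.1 + M 2 1 * p.2 + M 2 2 = projDenom M p := fun _ => rfl
  simp only [orient, projMap, h]
  field_simp
  simp only [projDenom, Matrix.det_fin_three]
  ring

theorem exists_projMap_eq {C M : Matrix (Fin 3) (Fin 3) ℝ} (hM : IsUnit M.det) {a b c : ℝ}
    (ha : 0 < a) (hb : 0 < b) (hD : M.transpose * C * M = Matrix.diagonal ![a, b, -c])
    {q : ℝ × ℝ} (hq : q ∈ conic C) :
    ∃ p : ℝ × ℝ, a * p.1 ^ 2 + b * p.2 ^ 2 = c ∧ projMap M p = q := by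
  obtain ⟨v, hv⟩ : ∃ v, M.mulVec v = ![q.1, q.2, 1] :=
    ⟨M⁻¹.mulVec ![q.1, q.2, 1], by rw [Matrix.mulVec_mulVec, Matrix.mul_nonsing_inv _ hM,
      Matrix.one_mulVec]⟩
  have hq0 : quad (M.transpose * C * M) v = 0 := by rw [← quad_congr, hv]; exact hq
  rw [hD, quad_diagonal] at hq0
  have e0 := congrFun hv 0
  have e1 := congrFun hv 1
  have e2 := congrFun hv 2
  simp only [Matrix.mulVec, dotProduct, Fin.sum_univ_three, Matrix.cons_val] at e0 e1 e2
  have h2 : v 2 ≠ 0 := by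
    intro h2
    rw [h2] at hq0
    have h0 : v 0 ^ 2 = 0 := by
      nlinarith [sq_nonneg (v 0), sq_nonneg (v 1),
        mul_nonneg ha.le (sq_nonneg (v 0)), mul_nonneg hb.le (sq_nonneg (v 1))]
    have h1 : v 1 ^ 2 = 0 := by
      nlinarith [sq_nonneg (v 0), sq_nonneg (v 1),
        mul_nonneg ha.le (sq_nonneg (v 0)), mul_nonneg hb.le (sq_nonneg (v 1))]
    rw [pow_eq_zero_iff two_ne_zero] at h0 h1
    rw [h0, h1, h2] at e2
    norm_num at e2
  have hden : M 2 0 * (v 0 / v 2) + M 2 1 * (v 1 / v 2) + M 2 2 = 1 / v 2 := by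
    field_simp; linarith
  refine ⟨(v 0 / v 2, v 1 / v 2), ?_, ?_⟩
  · field_simp; linarith
  · simp only [projMap, hden]
    ext
    · field_simp; linarith
    · field_simp; linarith

theorem det_ne_zero_of_orientation {M : Matrix (Fin 3) (Fin 3) ℝ} (h : 0 < M.det * M 2 2) :
    M.det ≠ 0 := by
  rintro h0
  simp [h0] at h

/-! ### The projective map on the closed unit disk -/

section Disk

variable {C M : Matrix (Fin 3) (Fin 3) ℝ}

theorem projDenom_ne_zero (hC : OrderedSignature C)
    (hD : M.transpose * C * M = Matrix.diagonal ![1, 1, -1]) (hM : IsUnit M.det)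
    {p : ℝ × ℝ} (hp : p.1 ^ 2 + p.2 ^ 2 ≤ 1) : projDenom M p ≠ 0 := by
  have hne : M.mulVec ![p.1, p.2, 1] ≠ 0 := by
    intro h
    have h2 := congrFun (Matrix.mulVec_injective_of_isUnit
      ((Matrix.isUnit_iff_isUnit_det M).2 hM) (h.trans (Matrix.mulVec_zero M).symm)) 2
    simp at h2
  have hq : quad C (M.mulVec ![p.1, p.2, 1]) ≤ 0 := by
    rw [quad_congr, hD, quad_diagonal]
    simp only [Matrix.cons_val]
    linarith
  have := hC.apply_two_ne_zero hne hq
  simpa [Matrix.mulVec, dotProduct, Fin.sum_univ_three, projDenom] using this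

/-- The denominator is affine with value `M 2 2` at the center; a change of sign would produce a
zero on a radius, inside the disk. -/
theorem projDenom_mul_pos (hC : OrderedSignature C)
    (hD : M.transpose * C * M = Matrix.diagonal ![1, 1, -1]) (hM : IsUnit M.det)
    {p : ℝ × ℝ} (hp : p.1 ^ 2 + p.2 ^ 2 ≤ 1) : 0 < projDenom M p * M 2 2 := by
  by_contra hle
  rw [not_lt] at hle
  have h0 : M 2 2 ≠ 0 := by
    have := projDenom_ne_zero hC hD hM (p := (0, 0)) (by norm_num)
    simpa [projDenom] using this
  have hpos : 0 < M 2 2 * (M 2 2 - projDenom M p) := by nlinarith [sq_pos_of_ne_zero h0]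
  have hne : M 2 2 - projDenom M p ≠ 0 := right_ne_zero_of_mul hpos.ne'
  -- The parameter at which the denominator vanishes along the segment from the center to p.
  obtain ⟨t, ht⟩ : ∃ t, t = M 2 2 / (M 2 2 - projDenom M p) := ⟨_, rfl⟩
  have ht1 : t ^ 2 ≤ 1 := by
    rw [ht, div_pow, div_le_one (by positivity)]
    nlinarith [sq_nonneg (projDenom M p)]
  refine projDenom_ne_zero hC hD hM (p := (t * p.1, t * p.2)) ?_ ?_
  · nlinarith [mul_le_mul_of_nonneg_left hp (sq_nonneg t)]
  · have : projDenom M (t * p.1, t * p.2) = M 2 2 - t * (M 2 2 - projDenom M p) := by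
      simp only [projDenom]; ring
    rw [this, ht]
    field_simp
    ring

theorem orient_projMap_pos (hC : OrderedSignature C)
    (hD : M.transpose * C * M = Matrix.diagonal ![1, 1, -1]) (hM : 0 < M.det * M 2 2)
    {a b c : ℝ × ℝ} (ha : a.1 ^ 2 + a.2 ^ 2 ≤ 1) (hb : b.1 ^ 2 + b.2 ^ 2 ≤ 1)
    (hc : c.1 ^ 2 + c.2 ^ 2 ≤ 1) (h : 0 < orient a b c) :
    0 < orient (projMap M a) (projMap M b) (projMap M c) := by
  have hu : IsUnit M.det := (det_ne_zero_of_orientation hM).isUnit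
  rw [orient_projMap (projDenom_ne_zero hC hD hu ha) (projDenom_ne_zero hC hD hu hb)
    (projDenom_ne_zero hC hD hu hc)]
  have h1 := projDenom_mul_pos hC hD hu ha
  have h2 := projDenom_mul_pos hC hD hu hb
  have h3 := projDenom_mul_pos hC hD hu hc
  -- The determinant and the three denominators all have the sign of `M 2 2`; multiplying the four
  -- positive products yields the factor `M 2 2 ^ 4`.
  have h4 : 0 < M.det * orient a b c * (projDenom M a * projDenom M b * projDenom M c) := by
    have h5 := mul_pos (mul_pos (mul_pos (mul_pos h1 h2) h3) hM) h
    have h0 : 0 < M 2 2 ^ 4 := by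
      have : M 2 2 ≠ 0 := right_ne_zero_of_mul hM.ne'
      positivity
    refine pos_of_mul_pos_left (b := M 2 2 ^ 4) ?_ h0.le
    calc 0 < _ := h5
      _ = _ := by ring
  rcases pos_and_pos_or_neg_and_neg_of_mul_pos h4 with ⟨h5, h6⟩ | ⟨h5, h6⟩
  · exact div_pos h5 h6
  · exact div_pos_of_neg_of_neg h5 h6

theorem projMap_mem_segment (hC : OrderedSignature C)
    (hD : M.transpose * C * M = Matrix.diagonal ![1, 1, -1]) (hM : IsUnit M.det)
    {a b p : ℝ × ℝ} (ha : a.1 ^ 2 + a.2 ^ 2 ≤ 1) (hb : b.1 ^ 2 + b.2 ^ 2 ≤ 1)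
    {t : ℝ} (ht0 : 0 ≤ t) (ht1 : t ≤ 1) (h1 : p.1 = (1 - t) * a.1 + t * b.1)
    (h2 : p.2 = (1 - t) * a.2 + t * b.2) :
    projMap M p ∈ segment ℝ (projMap M a) (projMap M b) := by
  have pa := projDenom_mul_pos hC hD hM ha
  have pb := projDenom_mul_pos hC hD hM hb
  have na := projDenom_ne_zero hC hD hM ha
  have nb := projDenom_ne_zero hC hD hM hb
  have hp : projDenom M p = (1 - t) * projDenom M a + t * projDenom M b := by
    simp only [projDenom, h1, h2]; ring
  have pp : 0 < projDenom M p * M 2 2 := by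
    rw [hp]
    rcases ht0.eq_or_lt with rfl | ht
    · simpa using pa
    · nlinarith [mul_pos ht pb, mul_nonneg (sub_nonneg.2 ht1) pa.le]
  have np : projDenom M p ≠ 0 := left_ne_zero_of_mul pp.ne'
  have n22 : M 2 2 ≠ 0 := right_ne_zero_of_mul pp.ne'
  have hdiv : ∀ x : ℝ × ℝ, projDenom M x / projDenom M p
      = (projDenom M x * M 2 2) / (projDenom M p * M 2 2) := fun x => by field_simp
  -- A projective map reweights convex combinations by the denominators; equal signs keep the new
  -- weights nonnegative.
  refine ⟨(1 - t) * (projDenom M a / projDenom M p), t * (projDenom M b / projDenom M p),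
    ?_, ?_, ?_, ?_⟩
  · rw [hdiv]; exact mul_nonneg (sub_nonneg.2 ht1) (div_pos pa pp).le
  · rw [hdiv]; exact mul_nonneg ht0 (div_pos pb pp).le
  · field_simp; exact hp.symm
  · have h : ∀ p : ℝ × ℝ, M 2 0 * p.1 + M 2 1 * p.2 + M 2 2 = projDenom M p := fun _ => rfl
    simp only [projMap, h]
    ext
    · simp only [Prod.smul_mk, Prod.mk_add_mk, smul_eq_mul]
      field_simp
      rw [h1, h2]; ring
    · simp only [Prod.smul_mk, Prod.mk_add_mk, smul_eq_mul]
      field_simp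
      rw [h1, h2]; ring

theorem projMap_injOn (hM : IsUnit M.det) {p q : ℝ × ℝ} (hp : projDenom M p ≠ 0)
    (hq : projDenom M q ≠ 0) (h : projMap M p = projMap M q) : p = q := by
  have e1 := mulVec_eq_smul_projMap hp
  have e2 := mulVec_eq_smul_projMap hq
  rw [h] at e1
  have e3 : M.mulVec (projDenom M q • ![p.1, p.2, 1])
      = M.mulVec (projDenom M p • ![q.1, q.2, 1]) := by
    rw [Matrix.mulVec_smul, Matrix.mulVec_smul, e1, e2, smul_comm]
  have e4 := Matrix.mulVec_injective_of_isUnit ((Matrix.isUnit_iff_isUnit_det M).2 hM) e3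
  have f0 := congrFun e4 0
  have f1 := congrFun e4 1
  have f2 := congrFun e4 2
  simp only [Pi.smul_apply, smul_eq_mul, Matrix.cons_val, mul_one] at f0 f1 f2
  rw [f2] at f0 f1
  exact Prod.ext (mul_left_cancel₀ hp f0) (mul_left_cancel₀ hp f1)

end Disk

/-! ### Diagonalizers and the pencil -/

theorem IsDiagonalizer.pencil {C₁ C₂ M : Matrix (Fin 3) (Fin 3) ℝ} {l₁ l₂ l₃ : ℝ}
    (hM : IsDiagonalizer C₁ C₂ l₁ l₂ l₃ M) (ν : ℝ × ℝ) :
    M.transpose * pencil C₁ C₂ ν * M = Matrix.diagonal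
      ![ν.1 + l₁ * ν.2, ν.1 + l₂ * ν.2, -(ν.1 + l₃ * ν.2)] := by
  rw [Poncelet.pencil, Matrix.mul_add, Matrix.add_mul, Matrix.mul_smul, Matrix.mul_smul,
    Matrix.smul_mul, Matrix.smul_mul, hM.diag₁, hM.diag₂]
  ext i j
  fin_cases i <;> fin_cases j <;> simp <;> ring

theorem quad_pencil (C₁ C₂ : Matrix (Fin 3) (Fin 3) ℝ) (ν : ℝ × ℝ) (v : Fin 3 → ℝ) :
    quad (pencil C₁ C₂ ν) v = ν.1 * quad C₁ v + ν.2 * quad C₂ v := by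
  simp [quad, pencil, Matrix.add_mulVec, Matrix.smul_mulVec]

/-- A member of the pencil with valid parameter does not meet the outer conic. -/
theorem StandingAssumptions.notMem_conic {C₁ C₂ : Matrix (Fin 3) (Fin 3) ℝ} {l₁ l₂ l₃ : ℝ}
    (hC : StandingAssumptions C₁ C₂ l₁ l₂ l₃) {ν : ℝ × ℝ} (hν : Valid l₃ ν) {p : ℝ × ℝ}
    (hp : p ∈ conic (pencil C₁ C₂ ν)) : p ∉ conic C₁ := by
  intro h1
  change _ = _ at h1 hp
  rw [quad_pencil, h1, mul_zero, zero_add, mul_eq_zero] at hp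
  have h2 := hp.resolve_left hν.1.ne'
  refine (hC.inside _ ?_ h2).ne h1
  intro h
  simpa using congrFun h 2

/-! ### Positive covers -/

theorem orient_swap (a b c : ℝ × ℝ) : orient a c b = -orient a b c := by
  simp only [orient]; ring

section Cover

variable {C : Set (ℝ × ℝ)} {c : ℝ → C}

/-- A continuous surjection of `ℝ` onto `C` whose fibres are the orbits of `θ ↦ θ + 1` identifies
`C` with the circle `ℝ / ℤ`. -/
theorem exists_addCircle_homeomorph (hcont : Continuous c) (hsurj : Function.Surjective c)
    (heq : ∀ s t : ℝ, c s = c t ↔ ∃ m : ℤ, t = s + m) :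
    ∃ H : AddCircle (1 : ℝ) ≃ₜ C, ∀ s : ℝ, H (s : AddCircle (1 : ℝ)) = c s := by
  have hper : Function.Periodic c 1 := fun s => ((heq s (s + 1)).2 ⟨1, by simp⟩).symm
  have hbij : Function.Bijective (hper.lift : AddCircle (1 : ℝ) → C) := by
    constructor
    · intro x y
      induction x using QuotientAddGroup.induction_on with | _ s => ?_
      induction y using QuotientAddGroup.induction_on with | _ t => ?_
      intro h
      obtain ⟨m, rfl⟩ := (heq s t).1 h
      rw [QuotientAddGroup.eq]
      exact AddSubgroup.mem_zmultiples_iff.2 ⟨m, by simp⟩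
    · intro z
      obtain ⟨s, rfl⟩ := hsurj z
      exact ⟨s, rfl⟩
  have hlift : Continuous (hper.lift : AddCircle (1 : ℝ) → C) := continuous_coinduced_dom.2 hcont
  exact ⟨hlift.homeoOfEquivCompactToT2 (f := Equiv.ofBijective _ hbij), fun s => rfl⟩

theorem isCoveringMap_of_fibers (hcont : Continuous c) (hsurj : Function.Surjective c)
    (heq : ∀ s t : ℝ, c s = c t ↔ ∃ m : ℤ, t = s + m) : IsCoveringMap c := by
  obtain ⟨H, hH⟩ := exists_addCircle_homeomorph hcont hsurj heq
  have : c = H ∘ ((↑) : ℝ → AddCircle (1 : ℝ)) := funext fun s => (hH s).symm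
  rw [this]
  exact (AddCircle.isCoveringMap_coe (1 : ℝ)).homeomorph_comp H

namespace IsPositiveCover

theorem exists_rotation (hc : IsPositiveCover c) (r : ℝ) :
    ∃ P : C ≃ₜ C, ∀ θ : ℝ, P (c θ) = c (θ + r) := by
  obtain ⟨H, hH⟩ := exists_addCircle_homeomorph hc.isCoveringMap.continuous hc.surjective hc.eq_iff
  refine ⟨H.symm.trans ((Homeomorph.addRight (r : AddCircle (1 : ℝ))).trans H), fun θ => ?_⟩
  rw [← hH, ← hH]
  simp

theorem add_int (hc : IsPositiveCover c) (s : ℝ) (m : ℤ) : c (s + m) = c s :=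
  ((hc.eq_iff s (s + m)).2 ⟨m, rfl⟩).symm

theorem exists_mem_Ico (hc : IsPositiveCover c) (s : ℝ) (z : C) :
    ∃ t ∈ Set.Ico s (s + 1), c t = z := by
  obtain ⟨t, rfl⟩ := hc.surjective z
  refine ⟨t - ⌊t - s⌋, ⟨?_, ?_⟩, ?_⟩
  · linarith [Int.floor_le (t - s)]
  · linarith [Int.lt_floor_add_one (t - s)]
  · rw [sub_eq_add_neg, ← Int.cast_neg, hc.add_int]

theorem eq_of_mem_Ico (hc : IsPositiveCover c) {a s t : ℝ} (hs : s ∈ Set.Ico a (a + 1))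
    (ht : t ∈ Set.Ico a (a + 1)) (h : c s = c t) : s = t := by
  obtain ⟨m, hm⟩ := (hc.eq_iff s t).1 h
  have h1 : ((-1 : ℤ) : ℝ) < m := by push_cast; linarith [hs.2, ht.1]
  have h2 : (m : ℝ) < ((1 : ℤ) : ℝ) := by push_cast; linarith [hs.1, ht.2]
  rw [Int.cast_lt] at h1 h2
  have : m = 0 := by omega
  simpa [this] using hm.symm

/-- Three pairwise distinct points of a positively covered curve are not collinear. -/
theorem eq_of_orient_eq_zero (hc : IsPositiveCover c) {z w w' : C} (hw : w ≠ z) (hw' : w' ≠ z)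
    (h : orient z w w' = 0) : w = w' := by
  obtain ⟨s, rfl⟩ := hc.surjective z
  obtain ⟨t, ht, rfl⟩ := hc.exists_mem_Ico s w
  obtain ⟨t', ht', rfl⟩ := hc.exists_mem_Ico s w'
  have hst : s < t := lt_of_le_of_ne ht.1 fun h => hw (by rw [h])
  have hst' : s < t' := lt_of_le_of_ne ht'.1 fun h => hw' (by rw [h])
  rcases lt_trichotomy t t' with hlt | heq | hlt
  · exact absurd h (hc.counterclockwise s t t' hst hlt ht'.2).ne'
  · rw [heq]
  · have := hc.counterclockwise s t' t hst' hlt ht.2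
    rw [orient_swap] at this
    linarith

/-- Two positive covers of the same curve differ by a strictly increasing degree one map. -/
theorem exists_strictMono_lift {c₀ : ℝ → C} (h₀ : IsPositiveCover c₀) (hc : IsPositiveCover c) :
    ∃ h : CircleDeg1Lift, StrictMono h ∧ ∀ x, c₀ (h x) = c x := by
  obtain ⟨a, ha⟩ := h₀.surjective (c 0)
  choose f hf hcf using fun x => h₀.exists_mem_Ico a (c x)
  -- Orientation of a triple belongs to the curve, not to the cover: if f reversed s and t, the
  -- triple c 0, c s, c t would be positively oriented through one cover and negatively through the
  -- other.
  have hmono : ∀ s t : ℝ, 0 ≤ s → s < t → t < 1 → f s < f t := by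
    intro s t hs hst ht
    have hinj : f s ≠ f t := by
      intro h
      have h1 : c s = c t := by rw [← hcf s, ← hcf t, h]
      exact hst.ne (hc.eq_of_mem_Ico (a := 0) ⟨hs, by linarith⟩ ⟨by linarith, by linarith⟩ h1)
    have ha0 : f 0 = a :=
      h₀.eq_of_mem_Ico (hf 0) ⟨le_rfl, by linarith⟩ ((hcf 0).trans ha.symm)
    rcases hs.eq_or_lt with rfl | hs
    · rw [ha0] at hinj ⊢
      exact lt_of_le_of_ne (hf t).1 hinj
    · by_contra hle
      have hlt : f t < f s := lt_of_le_of_ne (not_lt.1 hle) hinj.symm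
      have hat : a < f t := by
        refine lt_of_le_of_ne (hf t).1 fun h => ?_
        have h1 : c 0 = c t := by rw [← hcf t, ← h, ha]
        have := hc.eq_of_mem_Ico (a := 0) ⟨le_rfl, by norm_num⟩ ⟨by linarith, by linarith⟩ h1
        linarith
      have h1 := h₀.counterclockwise a (f t) (f s) hat hlt (hf s).2
      have h2 := hc.counterclockwise 0 s t hs hst (by linarith)
      rw [ha, hcf, hcf, orient_swap] at h1
      linarith
  have hstrict : StrictMono fun x : ℝ => f (Int.fract x) + ⌊x⌋ := by
    intro x y hxy
    rcases (Int.floor_mono hxy.le).eq_or_lt with h | h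
    · have hfr : Int.fract x < Int.fract y := by
        simp only [Int.fract, h]; linarith
      have := hmono _ _ (Int.fract_nonneg x) hfr (Int.fract_lt_one y)
      simp only [h]
      linarith
    · have h1 : (⌊x⌋ : ℝ) + 1 ≤ ⌊y⌋ := by exact_mod_cast h
      have h2 := (hf (Int.fract x)).2
      have h3 := (hf (Int.fract y)).1
      change f (Int.fract x) + ⌊x⌋ < f (Int.fract y) + ⌊y⌋
      linarith
  refine ⟨⟨⟨fun x => f (Int.fract x) + ⌊x⌋, hstrict.monotone⟩, fun x => ?_⟩, hstrict, fun x => ?_⟩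
  · simp [add_assoc]
  · change c₀ (f (Int.fract x) + ⌊x⌋) = c x
    rw [h₀.add_int, hcf]
    conv_rhs => rw [← Int.fract_add_floor x]
    rw [hc.add_int]

/-- A circle map which lifts to a translation through one positive cover has the translation
length, modulo `1`, as its rotation number. -/
theorem hasRotationNumber_iff (hc : IsPositiveCover c) {P : C → C} {σ : ℝ}
    (hP : ∀ θ, P (c θ) = c (θ + σ)) (r : ℝ) :
    HasRotationNumber P r ↔ ∃ m : ℤ, r = σ + m := by
  constructor
  · rintro ⟨c', hc', G, -, hG, rfl⟩
    obtain ⟨h, hmono, hh⟩ := hc.exists_strictMono_lift hc'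
    -- Both sides lift the same point, so they differ by an integer `m x`. Monotonicity and
    -- periodicity force `m` to be constant, so h semiconjugates G to a translation; continuity of h
    -- is not required.
    have hm : ∀ x, ∃ m : ℤ, h (G x) = h x + σ + m := by
      intro x
      refine (hc.eq_iff _ _).1 ?_
      rw [hh, ← hG, ← hh, hP]
    choose m hm using hm
    have hle : ∀ x y : ℝ, x ≤ y → y < x + 1 → m x ≤ m y := by
      intro x y hxy hyx
      have h1 : h (G x) ≤ h (G y) := h.monotone (G.monotone hxy)
      -- Strict monotonicity is essential: it gives m x < m y + 1, hence m x ≤ m y.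
      have h2 : h y < h x + 1 := by rw [← h.map_add_one]; exact hmono hyx
      rw [hm, hm] at h1
      have h3 : ((m x : ℤ) : ℝ) < ((m y + 1 : ℤ) : ℝ) := by push_cast; linarith
      rw [Int.cast_lt] at h3
      omega
    have hm1 : ∀ x, m (x + 1) = m x := by
      intro x
      have h1 := hm (x + 1)
      rw [G.map_add_one, h.map_add_one, h.map_add_one, hm] at h1
      have h2 : ((m (x + 1) : ℤ) : ℝ) = m x := by linarith
      exact_mod_cast h2
    have hconst1 : ∀ x y : ℝ, x ≤ y → y < x + 1 → m x = m y := by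
      intro x y hxy hyx
      refine le_antisymm (hle x y hxy hyx) ?_
      rcases hxy.eq_or_lt with rfl | hlt
      · exact le_rfl
      · rw [← hm1 x]
        exact hle _ _ hyx.le (by linarith)
    have hper : Function.Periodic m 1 := hm1
    have hconst : ∀ x, m x = m 0 := by
      intro x
      have h1 := hper.sub_zsmul_eq ⌊x⌋ (x := x)
      rw [zsmul_one] at h1
      rw [← h1]
      change m (Int.fract x) = m 0
      exact (hconst1 _ _ (Int.fract_nonneg x) (by linarith [Int.fract_lt_one x])).symm
    refine ⟨m 0, ?_⟩
    rw [← CircleDeg1Lift.translationNumber_translate (σ + m 0)]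
    refine CircleDeg1Lift.translationNumber_eq_of_semiconj (f := h) fun x => ?_
    rw [CircleDeg1Lift.translate_apply, hm, hconst]
    ring
  · rintro ⟨m, rfl⟩
    refine ⟨c, hc, CircleDeg1Lift.translate (Multiplicative.ofAdd (σ + m)), ?_, fun θ => ?_, ?_⟩
    · have : ⇑(CircleDeg1Lift.translate (Multiplicative.ofAdd (σ + m)) : CircleDeg1Lift)
          = fun x => (σ + m) + x := funext fun x => CircleDeg1Lift.translate_apply _ _
      rw [this]
      fun_prop
    · rw [hP, CircleDeg1Lift.translate_apply, ← hc.add_int _ m]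
      congr 1
      ring
    · exact CircleDeg1Lift.translationNumber_translate _

theorem tfae_of_lift (hc : IsPositiveCover c) {P : C → C} {σ : ℝ}
    (hP : ∀ θ, P (c θ) = c (θ + σ)) :
    List.TFAE [∀ z, P z = z, ∃ m : ℤ, σ = m, ∃ z, P z = z] := by
  tfae_have 1 → 3 := fun h => ⟨c 0, h _⟩
  tfae_have 3 → 2 := by
    rintro ⟨z, hz⟩
    obtain ⟨θ, rfl⟩ := hc.surjective z
    rw [hP] at hz
    obtain ⟨m, hm⟩ := (hc.eq_iff _ _).1 hz.symm
    exact ⟨m, by linarith⟩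
  tfae_have 2 → 1 := by
    rintro ⟨m, rfl⟩ z
    obtain ⟨θ, rfl⟩ := hc.surjective z
    rw [hP, hc.add_int]
  tfae_finish

end IsPositiveCover

/-! ### Lifts of powers and compositions -/

theorem zpow_lift {P : C ≃ₜ C} {r : ℝ} (hP : ∀ θ, P (c θ) = c (θ + r)) (k : ℤ) (θ : ℝ) :
    (P ^ k) (c θ) = c (θ + k * r) := by
  have hinv : ∀ θ, P⁻¹ (c θ) = c (θ - r) := by
    intro θ
    have h := hP (θ - r)
    rw [sub_add_cancel] at h
    rw [← h]
    exact P.symm_apply_apply _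
  induction k using Int.induction_on generalizing θ with
  | zero => simp
  | succ n ih =>
    rw [zpow_add_one, Homeomorph.mul_apply, hP, ih]
    congr 1; push_cast; ring
  | pred n ih =>
    rw [zpow_sub_one, Homeomorph.mul_apply, hinv, ih]
    congr 1; push_cast; ring

theorem reverse_prod_ofFn_lift {N : ℕ} {P : Fin N → (C ≃ₜ C)} {r : Fin N → ℝ}
    (hP : ∀ j θ, P j (c θ) = c (θ + r j)) (θ : ℝ) :
    (List.ofFn P).reverse.prod (c θ) = c (θ + ∑ j, r j) := by
  induction N generalizing θ with
  | zero => simp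
  | succ n ih =>
    rw [List.ofFn_succ, List.reverse_cons, List.prod_append, List.prod_singleton,
      Homeomorph.mul_apply, hP, ih (fun j θ => hP j.succ θ), Fin.sum_univ_succ, add_assoc]

end Cover

/-! ### Simultaneous diagonalization -/

theorem mul_mul_transpose_of (C : Matrix (Fin 3) (Fin 3) ℝ) (v : Fin 3 → Fin 3 → ℝ) (i j : Fin 3) :
    (Matrix.of v * C * (Matrix.of v).transpose) i j = v i ⬝ᵥ C.mulVec (v j) := by
  rw [Matrix.mul_assoc, Matrix.mul_apply']
  rfl

theorem dotProduct_mulVec_comm {C : Matrix (Fin 3) (Fin 3) ℝ} (hC : C.IsSymm) (u v : Fin 3 → ℝ) :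
    u ⬝ᵥ C.mulVec v = v ⬝ᵥ C.mulVec u := by
  rw [Matrix.dotProduct_mulVec, dotProduct_comm, ← Matrix.mulVec_transpose, hC.eq]

/-- A basis of generalized eigenvectors diagonalizes both forms. -/
theorem StandingAssumptions.exists_eigenbasis {C₁ C₂ : Matrix (Fin 3) (Fin 3) ℝ} {l₁ l₂ l₃ : ℝ}
    (hC : StandingAssumptions C₁ C₂ l₁ l₂ l₃) :
    ∃ (V : Matrix (Fin 3) (Fin 3) ℝ) (q : Fin 3 → ℝ), IsUnit V.det ∧
      V.transpose * C₁ * V = Matrix.diagonal q ∧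
      V.transpose * C₂ * V = Matrix.diagonal fun i => ![l₁, l₂, l₃] i * q i := by
  have heig : ∀ i, Module.End.HasEigenvalue (Matrix.toLin' (C₁⁻¹ * C₂)) (![l₁, l₂, l₃] i) := by
    intro i
    fin_cases i
    exacts [hC.eig₁, hC.eig₂, hC.eig₃]
  have hinj : Function.Injective ![l₁, l₂, l₃] := by
    have h1 := hC.lt₁₂
    have h2 := hC.lt₂₃
    intro i j h
    fin_cases i <;> fin_cases j <;> simp at h ⊢ <;> linarith
  choose v hv using fun i => (heig i).exists_hasEigenvector
  have hli := Module.End.eigenvectors_linearIndependent' _ _ hinj v hv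
  have hmul : ∀ i, C₂.mulVec (v i) = ![l₁, l₂, l₃] i • C₁.mulVec (v i) := by
    intro i
    have h := (hv i).apply_eq_smul
    rw [Matrix.toLin'_apply, ← Matrix.mulVec_mulVec] at h
    rw [← Matrix.mulVec_smul, ← h, Matrix.mulVec_mulVec,
      Matrix.mul_nonsing_inv _ hC.sig₁.det_neg.ne.isUnit, Matrix.one_mulVec]
  -- Symmetry of both forms gives (lⱼ - lᵢ) vᵢᵀC₁vⱼ = 0.
  have horth : ∀ i j, i ≠ j → v i ⬝ᵥ C₁.mulVec (v j) = 0 := by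
    intro i j hij
    have h := dotProduct_mulVec_comm hC.sig₂.symm (v i) (v j)
    rw [hmul, hmul, dotProduct_smul, dotProduct_smul,
      dotProduct_mulVec_comm hC.sig₁.symm (v j) (v i), ← sub_eq_zero, ← sub_smul,
      smul_eq_zero, sub_eq_zero] at h
    exact h.resolve_left fun h => hij (hinj h.symm)
  refine ⟨(Matrix.of v).transpose, fun i => v i ⬝ᵥ C₁.mulVec (v i), ?_, ?_, ?_⟩
  · rw [Matrix.det_transpose, ← Matrix.isUnit_iff_isUnit_det]
    exact Matrix.linearIndependent_rows_iff_isUnit.1 hli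
  · ext i j
    rw [Matrix.transpose_transpose, mul_mul_transpose_of, Matrix.diagonal_apply]
    split_ifs with h
    · rw [h]
    · exact horth i j h
  · ext i j
    rw [Matrix.transpose_transpose, mul_mul_transpose_of, hmul, dotProduct_smul,
      Matrix.diagonal_apply]
    split_ifs with h
    · rw [h, smul_eq_mul]
    · rw [horth i j h, smul_zero]

theorem quad_diagonal_sum (q v : Fin 3 → ℝ) :
    quad (Matrix.diagonal q) v = ∑ i, q i * v i ^ 2 := by
  simp only [quad, dotProduct, Matrix.mulVec_diagonal]
  exact Finset.sum_congr rfl fun i _ => by ring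

/-- The inclusion of the inner conic in the outer one orders the signs of the diagonal form. -/
theorem StandingAssumptions.not_neg_pos {C₁ C₂ V : Matrix (Fin 3) (Fin 3) ℝ} {l₁ l₂ l₃ : ℝ}
    (hC : StandingAssumptions C₁ C₂ l₁ l₂ l₃) {q l : Fin 3 → ℝ} (hV : IsUnit V.det)
    (h₁ : V.transpose * C₁ * V = Matrix.diagonal q)
    (h₂ : V.transpose * C₂ * V = Matrix.diagonal fun i => l i * q i)
    {i j : Fin 3} (hl : 0 < l j) (hij : l j < l i) (hi : q i < 0) : q j ≤ 0 := by
  by_contra! hj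
  have hne : i ≠ j := by rintro rfl; exact lt_irrefl _ hij
  have hli : 0 < l i := hl.trans hij
  have ha : 0 ≤ l j * q j := by positivity
  have hb : 0 ≤ l i * -q i := mul_nonneg hli.le (by linarith)
  -- Chosen so that V x is a null vector of `C₂`; there `C₁` takes the value qᵢqⱼ(lⱼ - lᵢ) > 0,
  -- against `inside`.
  let x : Fin 3 → ℝ := Pi.single i (Real.sqrt (l j * q j)) + Pi.single j (Real.sqrt (l i * -q i))
  have hxi : x i = Real.sqrt (l j * q j) := by simp [x, hne]
  have hxj : x j = Real.sqrt (l i * -q i) := by simp [x, hne.symm]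
  have hx0 : ∀ k, k ≠ i ∧ k ≠ j → x k = 0 := fun k hk => by simp [x, hk.1, hk.2]
  have hsum : ∀ f : Fin 3 → ℝ, ∑ k, f k * x k ^ 2 = f i * (l j * q j) + f j * (l i * -q i) := by
    intro f
    rw [Fintype.sum_eq_add i j hne fun k hk => by rw [hx0 k hk]; ring, hxi, hxj,
      Real.sq_sqrt ha, Real.sq_sqrt hb]
  have hxne : V.mulVec x ≠ 0 := by
    intro h
    have := Matrix.mulVec_injective_of_isUnit ((Matrix.isUnit_iff_isUnit_det V).2 hV)
      (h.trans (Matrix.mulVec_zero V).symm)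
    rw [this] at hxi
    exact (Real.sqrt_pos.2 (mul_pos hl hj)).ne hxi
  have hin := hC.inside _ hxne (by rw [quad_congr, h₂, quad_diagonal_sum, hsum]; ring)
  rw [quad_congr, h₁, quad_diagonal_sum, hsum] at hin
  nlinarith [mul_pos (mul_pos (neg_pos.2 hi) hj) (sub_pos.2 hij)]

/-- The negative determinant makes the number of negative qᵢ odd, and some qᵢ is positive, so
exactly one is negative. By `not_neg_pos` it belongs to the smallest eigenvalue. Rescaling the
columns normalizes the forms. -/
theorem StandingAssumptions.exists_isDiagonalizer {C₁ C₂ : Matrix (Fin 3) (Fin 3) ℝ} {l₁ l₂ l₃ : ℝ}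
    (hC : StandingAssumptions C₁ C₂ l₁ l₂ l₃) :
    ∃ M : Matrix (Fin 3) (Fin 3) ℝ, IsDiagonalizer C₁ C₂ l₁ l₂ l₃ M := by
  obtain ⟨V, q, hV, h₁, h₂⟩ := hC.exists_eigenbasis
  have hdet : q 0 * q 1 * q 2 < 0 := by
    have h := congrArg Matrix.det h₁
    rw [Matrix.det_mul, Matrix.det_mul, Matrix.det_transpose, Matrix.det_diagonal,
      Fin.prod_univ_three] at h
    have := mul_pos_of_neg_of_neg hC.sig₁.det_neg (neg_neg_of_pos (sq_pos_of_ne_zero hV.ne_zero))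
    nlinarith
  have hpos : ∃ i, 0 < q i := by
    by_contra! hle
    have h1 : quad C₁ (V.mulVec (V⁻¹.mulVec ![1, 0, 0])) = quad C₁ ![1, 0, 0] := by
      rw [Matrix.mulVec_mulVec, Matrix.mul_nonsing_inv _ hV, Matrix.one_mulVec]
    rw [quad_congr, h₁, quad_diagonal_sum] at h1
    have h2 := hC.sig₁.posDef 1 0 (by simp)
    rw [← h1] at h2
    exact h2.not_ge (Finset.sum_nonpos fun i _ =>
      mul_nonpos_of_nonpos_of_nonneg (hle i) (sq_nonneg _))
  have hl2 : 0 < l₂ := hC.pos₃.trans hC.lt₂₃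
  have h01 : q 0 < 0 → q 1 ≤ 0 := hC.not_neg_pos (i := 0) (j := 1) hV h₁ h₂ hl2 hC.lt₁₂
  have h02 : q 0 < 0 → q 2 ≤ 0 :=
    hC.not_neg_pos (i := 0) (j := 2) hV h₁ h₂ hC.pos₃ (hC.lt₂₃.trans hC.lt₁₂)
  have h12 : q 1 < 0 → q 2 ≤ 0 := hC.not_neg_pos (i := 1) (j := 2) hV h₁ h₂ hC.pos₃ hC.lt₂₃
  have hq0 : q 0 ≠ 0 := by rintro h; simp [h] at hdet
  have hq1 : q 1 ≠ 0 := by rintro h; simp [h] at hdet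
  have p0 : 0 < q 0 := by
    by_contra hle
    have hn : q 0 < 0 := lt_of_le_of_ne (not_lt.1 hle) hq0
    obtain ⟨i, hi⟩ := hpos
    fin_cases i
    · exact hle hi
    · exact (h01 hn).not_gt hi
    · exact (h02 hn).not_gt hi
  have p1 : 0 < q 1 := by
    by_contra hle
    have hn : q 1 < 0 := lt_of_le_of_ne (not_lt.1 hle) hq1
    nlinarith [mul_nonneg_of_nonpos_of_nonpos (mul_neg_of_pos_of_neg p0 hn).le (h12 hn)]
  have p2 : q 2 < 0 := by
    by_contra hle
    nlinarith [mul_nonneg (mul_pos p0 p1).le (not_lt.1 hle)]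
  -- The sign ε on the first column leaves both forms unchanged but flips det M without touching `M
  -- 2 2`, so one choice of ε has the right orientation.
  have hscale : ∀ ε : ℝ, ε ^ 2 = 1 →
      let M := V * Matrix.diagonal ![ε / Real.sqrt (q 0), 1 / Real.sqrt (q 1),
        1 / Real.sqrt (-q 2)]
      M.transpose * C₁ * M = Matrix.diagonal ![1, 1, -1] ∧
      M.transpose * C₂ * M = Matrix.diagonal ![l₁, l₂, -l₃] := by
    intro ε hε M
    have hM : ∀ C : Matrix (Fin 3) (Fin 3) ℝ, M.transpose * C * M
        = Matrix.diagonal ![ε / Real.sqrt (q 0), 1 / Real.sqrt (q 1), 1 / Real.sqrt (-q 2)]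
          * (V.transpose * C * V)
          * Matrix.diagonal ![ε / Real.sqrt (q 0), 1 / Real.sqrt (q 1), 1 / Real.sqrt (-q 2)] := by
      intro C
      simp only [M, Matrix.transpose_mul, Matrix.diagonal_transpose, Matrix.mul_assoc]
    have s0 := Real.sq_sqrt p0.le
    have s1 := Real.sq_sqrt p1.le
    have s2 := Real.sq_sqrt (neg_pos.2 p2).le
    have t0 := Real.sqrt_pos.2 p0
    have t1 := Real.sqrt_pos.2 p1
    have t2 := Real.sqrt_pos.2 (neg_pos.2 p2)
    rw [hM, hM, h₁, h₂]
    simp only [Matrix.diagonal_mul_diagonal]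
    constructor
    · congr 1
      ext i
      fin_cases i <;> simp only [Fin.zero_eta, Fin.mk_one, Fin.reduceFinMk, Matrix.cons_val] <;>
        field_simp
      · rw [hε, s0, one_mul]
      · rw [s1]
      · rw [s2]; ring
    · congr 1
      ext i
      fin_cases i <;> simp only [Fin.zero_eta, Fin.mk_one, Fin.reduceFinMk, Matrix.cons_val] <;>
        field_simp
      · rw [hε, s0]; ring
      · rw [s1]
      · rw [s2]; ring
  obtain ⟨ha, hb⟩ := hscale 1 (by norm_num)
  obtain ⟨ha', hb'⟩ := hscale (-1) (by norm_num)
  have hdetM : ∀ ε : ℝ, (V * Matrix.diagonal ![ε / Real.sqrt (q 0), 1 / Real.sqrt (q 1),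
      1 / Real.sqrt (-q 2)]).det * (V * Matrix.diagonal ![ε / Real.sqrt (q 0),
      1 / Real.sqrt (q 1), 1 / Real.sqrt (-q 2)]) 2 2
      = ε * (V.det / (Real.sqrt (q 0) * Real.sqrt (q 1) * Real.sqrt (-q 2))
        * (V 2 2 / Real.sqrt (-q 2))) := by
    intro ε
    rw [Matrix.det_mul, Matrix.det_diagonal, Fin.prod_univ_three, Matrix.mul_diagonal]
    simp only [Matrix.cons_val]
    ring
  have hV22 : V 2 2 ≠ 0 := by
    have hne : V.mulVec (Pi.single 2 1) ≠ 0 := by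
      intro h
      have := congrFun (Matrix.mulVec_injective_of_isUnit ((Matrix.isUnit_iff_isUnit_det V).2 hV)
        (h.trans (Matrix.mulVec_zero V).symm)) 2
      simp at this
    have hq : quad C₁ (V.mulVec (Pi.single 2 1)) ≤ 0 := by
      rw [quad_congr, h₁, quad_diagonal_sum, Fin.sum_univ_three]
      simp [p2.le]
    simpa using hC.sig₁.apply_two_ne_zero hne hq
  have hne : V.det / (Real.sqrt (q 0) * Real.sqrt (q 1) * Real.sqrt (-q 2))
      * (V 2 2 / Real.sqrt (-q 2)) ≠ 0 := by
    have t0 := Real.sqrt_pos.2 p0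
    have t1 := Real.sqrt_pos.2 p1
    have t2 := Real.sqrt_pos.2 (neg_pos.2 p2)
    have := hV.ne_zero
    positivity
  rcases hne.lt_or_gt with h | h
  · exact ⟨_, ha', hb', by rw [hdetM]; linarith⟩
  · exact ⟨_, ha, hb, by rw [hdetM]; linarith⟩

/-! ### The standard cover -/

section Standard

variable {C₁ C₂ M : Matrix (Fin 3) (Fin 3) ℝ} {l₁ l₂ l₃ : ℝ}

theorem eccentricity_nonneg (l₁ l₂ l₃ : ℝ) : 0 ≤ eccentricity l₁ l₂ l₃ := Real.sqrt_nonneg _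

theorem eccentricity_sq (h₁ : l₂ < l₁) (h₂ : l₃ < l₂) :
    eccentricity l₁ l₂ l₃ ^ 2 = (l₁ - l₂) / (l₁ - l₃) :=
  Real.sq_sqrt (div_nonneg (by linarith) (by linarith))

theorem eccentricity_lt_one (h₁ : l₂ < l₁) (h₂ : l₃ < l₂) : eccentricity l₁ l₂ l₃ < 1 := by
  rw [eccentricity, Real.sqrt_lt' one_pos, div_lt_iff₀ (by linarith)]
  linarith

theorem jacobiAm_add_int_mul {e : ℝ} (he0 : 0 ≤ e) (he1 : e < 1) (u : ℝ) (m : ℤ) :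
    jacobiAm (u + m * (4 * ellK e)) e = jacobiAm u e + m * (2 * Real.pi) := by
  have hK := ellK_pos he0 he1
  -- Subtracting the linear drift makes the amplitude periodic, so integer multiples of the period
  -- come for free.
  have hper : Function.Periodic
      (fun u => jacobiAm u e - u * (2 * Real.pi) / (4 * ellK e)) (4 * ellK e) := by
    intro u
    simp only [jacobiAm_add_four_ellK he0 he1]
    field_simp
    ring
  have h := hper.int_mul m u
  simp only [add_mul, add_div] at h
  have h1 : (m : ℝ) * (4 * ellK e) * (2 * Real.pi) / (4 * ellK e) = m * (2 * Real.pi) := by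
    field_simp
  linarith

theorem circlePoint_eq_iff {e : ℝ} (he0 : 0 ≤ e) (he1 : e < 1) (u v : ℝ) :
    circlePoint e u = circlePoint e v ↔ ∃ m : ℤ, v = u + m * (4 * ellK e) := by
  constructor
  · intro h
    have hang := Real.Angle.cos_sin_inj (Prod.ext_iff.1 h).1 (Prod.ext_iff.1 h).2
    obtain ⟨k, hk⟩ := Real.Angle.angle_eq_iff_two_pi_dvd_sub.1 hang
    refine ⟨-k, (strictMono_jacobiAm he0 he1).injective ?_⟩
    simp only [jacobiAm_add_int_mul he0 he1]
    push_cast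
    linarith
  · rintro ⟨m, rfl⟩
    simp only [circlePoint, jacobiCn, jacobiSn, jacobiAm_add_int_mul he0 he1,
      Real.cos_add_int_mul_two_pi, Real.sin_add_int_mul_two_pi]

theorem exists_circlePoint_eq {e : ℝ} (he0 : 0 ≤ e) (he1 : e < 1) {p : ℝ × ℝ}
    (hp : p.1 ^ 2 + p.2 ^ 2 = 1) : ∃ u, circlePoint e u = p := by
  have hz : ‖(⟨p.1, p.2⟩ : ℂ)‖ = 1 := by
    rw [← sq_eq_sq₀ (norm_nonneg _) zero_le_one, ← Complex.normSq_eq_norm_sq, Complex.normSq_mk]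
    linarith
  refine ⟨ellF (Complex.arg ⟨p.1, p.2⟩) e, ?_⟩
  have hz0 : (⟨p.1, p.2⟩ : ℂ) ≠ 0 := by
    intro h
    rw [h, norm_zero] at hz
    exact zero_ne_one hz
  simp only [circlePoint, jacobiCn, jacobiSn, jacobiAm_ellF he0 he1]
  rw [Complex.cos_arg hz0, Complex.sin_arg, hz]
  simp

theorem continuous_circlePoint {e : ℝ} (he0 : 0 ≤ e) (he1 : e < 1) :
    Continuous (circlePoint e) :=
  (Real.continuous_cos.comp (continuous_jacobiAm he0 he1)).prodMk
    (Real.continuous_sin.comp (continuous_jacobiAm he0 he1))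

theorem IsDiagonalizer.isUnit_det (hM : IsDiagonalizer C₁ C₂ l₁ l₂ l₃ M) : IsUnit M.det :=
  (det_ne_zero_of_orientation hM.orientation).isUnit

theorem IsDiagonalizer.projMap_mem_conic (hC : OrderedSignature C₁)
    (hM : IsDiagonalizer C₁ C₂ l₁ l₂ l₃ M) {p : ℝ × ℝ} (hp : p.1 ^ 2 + p.2 ^ 2 = 1) :
    projMap M p ∈ conic C₁ := by
  have hd := projDenom_ne_zero hC hM.diag₁ hM.isUnit_det hp.le
  have h := quad_projMap (C := C₁) hd
  rw [hM.diag₁, quad_diagonal] at h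
  simp only [Matrix.cons_val] at h
  have h0 : projDenom M p ^ 2 * quad C₁ ![(projMap M p).1, (projMap M p).2, 1] = 0 := by
    rw [← h]; linarith
  exact (mul_eq_zero.1 h0).resolve_left (pow_ne_zero 2 hd)

/-- The standard cover, with values in the outer conic. -/
def conicCover (hC : OrderedSignature C₁) (hM : IsDiagonalizer C₁ C₂ l₁ l₂ l₃ M) (e θ : ℝ) :
    conic C₁ :=
  ⟨standardCover M e θ, hM.projMap_mem_conic hC (circlePoint_mem e _)⟩

theorem isPositiveCover_conicCover (hC : OrderedSignature C₁)
    (hM : IsDiagonalizer C₁ C₂ l₁ l₂ l₃ M) {e : ℝ} (he0 : 0 ≤ e) (he1 : e < 1) :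
    IsPositiveCover (conicCover hC hM e) := by
  have hK := ellK_pos he0 he1
  have hd : ∀ u, projDenom M (circlePoint e u) ≠ 0 := fun u =>
    projDenom_ne_zero hC hM.diag₁ hM.isUnit_det (circlePoint_mem e u).le
  have hcont : Continuous (conicCover hC hM e) := by
    have h1 : Continuous fun θ : ℝ => circlePoint e (4 * ellK e * θ) :=
      (continuous_circlePoint he0 he1).comp (continuous_const.mul continuous_id)
    have h2 := continuous_fst.comp h1
    have h3 := continuous_snd.comp h1
    refine Continuous.subtype_mk (Continuous.prodMk ?_ ?_) _
    · exact (((continuous_const.mul h2).add (continuous_const.mul h3)).add continuous_const).div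
        (((continuous_const.mul h2).add (continuous_const.mul h3)).add continuous_const)
        fun θ => hd _
    · exact (((continuous_const.mul h2).add (continuous_const.mul h3)).add continuous_const).div
        (((continuous_const.mul h2).add (continuous_const.mul h3)).add continuous_const)
        fun θ => hd _
  have hsurj : Function.Surjective (conicCover hC hM e) := by
    rintro ⟨q, hq⟩
    obtain ⟨p, hp, rfl⟩ := exists_projMap_eq hM.isUnit_det one_pos one_pos hM.diag₁ hq
    obtain ⟨u, rfl⟩ := exists_circlePoint_eq he0 he1 (p := p) (by linarith)
    refine ⟨u / (4 * ellK e), Subtype.ext ?_⟩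
    change projMap M (circlePoint e (4 * ellK e * (u / (4 * ellK e)))) = _
    rw [mul_div_cancel₀ _ (by positivity)]
  have heq : ∀ s t : ℝ, conicCover hC hM e s = conicCover hC hM e t ↔ ∃ m : ℤ, t = s + m := by
    intro s t
    have h1 : conicCover hC hM e s = conicCover hC hM e t ↔
        circlePoint e (4 * ellK e * s) = circlePoint e (4 * ellK e * t) := by
      rw [Subtype.ext_iff]
      exact ⟨projMap_injOn hM.isUnit_det (hd _) (hd _), fun h => congrArg (projMap M) h⟩
    rw [h1, circlePoint_eq_iff he0 he1]
    refine exists_congr fun m => ⟨fun h => ?_, fun h => ?_⟩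
    · refine mul_left_cancel₀ (show 4 * ellK e ≠ 0 by positivity) ?_
      linarith
    · rw [h]; ring
  refine ⟨isCoveringMap_of_fibers hcont hsurj heq, hsurj, heq, fun s t u hst htu hus => ?_⟩
  refine orient_projMap_pos hC hM.diag₁ hM.orientation (circlePoint_mem e _).le
    (circlePoint_mem e _).le (circlePoint_mem e _).le (orient_circle ?_ ?_ ?_)
  · exact strictMono_jacobiAm he0 he1 (by nlinarith)
  · exact strictMono_jacobiAm he0 he1 (by nlinarith)
  · rw [← jacobiAm_add_four_ellK he0 he1]
    exact strictMono_jacobiAm he0 he1 (by nlinarith)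

/-! ### The Poncelet maps of the pencil -/

/-- The angle ω is defined to make the cn² relation hold; the dn² relation then follows because e² =
(l₁ - l₂)/(l₁ - l₃). Together they identify the envelope of the chords with `C_ν`. -/
theorem omega_spec (h₁ : l₂ < l₁) (h₂ : l₃ < l₂) {ν : ℝ × ℝ} (hν : Valid l₃ ν) :
    let e := eccentricity l₁ l₂ l₃
    let w := ellF (omega l₁ l₃ ν) e
    0 < jacobiSn w e ∧ 0 < jacobiCn w e ∧
      (ν.1 + l₁ * ν.2) * jacobiCn w e ^ 2 = ν.1 + l₃ * ν.2 ∧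
      (ν.1 + l₁ * ν.2) * jacobiDn w e ^ 2 = ν.1 + l₂ * ν.2 := by
  intro e w
  obtain ⟨hν2, hν3⟩ := hν
  have he0 : 0 ≤ e := eccentricity_nonneg _ _ _
  have he1 : e < 1 := eccentricity_lt_one h₁ h₂
  have ha : 0 < l₁ * ν.2 + ν.1 := by nlinarith
  obtain ⟨x, hx⟩ : ∃ x, x = (l₁ - l₃) * ν.2 / (l₁ * ν.2 + ν.1) := ⟨_, rfl⟩
  have hx0 : 0 < x := by rw [hx]; exact div_pos (mul_pos (by linarith) hν2) ha
  have hx1 : x < 1 := by rw [hx, div_lt_one ha]; linarith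
  have hax : (l₁ * ν.2 + ν.1) * x = (l₁ - l₃) * ν.2 := by rw [hx]; field_simp
  have hsx : Real.sqrt x ≤ 1 := Real.sqrt_le_one.2 hx1.le
  have hs : jacobiSn w e = Real.sqrt x := by
    simp only [jacobiSn, w, jacobiAm_ellF he0 he1, omega, ← hx]
    exact Real.sin_arcsin (by linarith [Real.sqrt_nonneg x]) hsx
  have hc : jacobiCn w e = Real.sqrt (1 - x) := by
    simp only [jacobiCn, w, jacobiAm_ellF he0 he1, omega, ← hx]
    rw [Real.cos_arcsin, Real.sq_sqrt hx0.le]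
  refine ⟨?_, ?_, ?_, ?_⟩
  · rw [hs]; exact Real.sqrt_pos.2 hx0
  · rw [hc]; exact Real.sqrt_pos.2 (by linarith)
  · rw [hc, Real.sq_sqrt (by linarith)]; linarith
  · have hd := jacobiDn_sq he0 he1 w
    rw [hs, Real.sq_sqrt hx0.le, eccentricity_sq h₁ h₂] at hd
    rw [hd]
    have h13 : l₁ - l₃ ≠ 0 := by linarith
    have : (l₁ - l₂) / (l₁ - l₃) * ((l₁ * ν.2 + ν.1) * x) = (l₁ - l₂) * ν.2 := by
      rw [hax]; field_simp
    linear_combination -this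

theorem StandingAssumptions.positivelyTangent (hC : StandingAssumptions C₁ C₂ l₁ l₂ l₃)
    (hM : IsDiagonalizer C₁ C₂ l₁ l₂ l₃ M) {ν : ℝ × ℝ} (hν : Valid l₃ ν) (θ : ℝ) :
    PositivelyTangent (conic (pencil C₁ C₂ ν))
      (conicCover hC.sig₁ hM (eccentricity l₁ l₂ l₃) θ)
      (conicCover hC.sig₁ hM (eccentricity l₁ l₂ l₃) (θ + rho l₁ l₂ l₃ ν)) := by
  have he0 : 0 ≤ eccentricity l₁ l₂ l₃ := eccentricity_nonneg _ _ _
  have he1 : eccentricity l₁ l₂ l₃ < 1 := eccentricity_lt_one hC.lt₁₂ hC.lt₂₃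
  obtain ⟨hsn, hcn, hcsq, hdsq⟩ := omega_spec hC.lt₁₂ hC.lt₂₃ hν
  have hdn := jacobiDn_pos he0 he1 (ellF (omega l₁ l₃ ν) (eccentricity l₁ l₂ l₃))
  have hK := ellK_pos he0 he1
  have hrho : rho l₁ l₂ l₃ ν = ellF (omega l₁ l₃ ν) (eccentricity l₁ l₂ l₃)
    / (2 * ellK (eccentricity l₁ l₂ l₃)) := rfl
  have hl2 := hC.lt₂₃
  have hl1 := hC.lt₁₂
  obtain ⟨hν2, hν3⟩ := hν
  have pc : 0 < ν.1 + l₃ * ν.2 := hν3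
  have pb : 0 < ν.1 + l₂ * ν.2 := by nlinarith
  have pa : 0 < ν.1 + l₁ * ν.2 := by nlinarith
  generalize eccentricity l₁ l₂ l₃ = e at *
  generalize hw : ellF (omega l₁ l₃ ν) e = w at *
  -- The midpoint parameter: since 4Kρ = 2w, the endpoints θ and θ + ρ correspond to u - w and u +
  -- w.
  obtain ⟨u, hu⟩ : ∃ u, u = 4 * ellK e * θ + w := ⟨_, rfl⟩
  have hz : (conicCover hC.sig₁ hM e θ : ℝ × ℝ) = projMap M (circlePoint e (u - w)) := by
    rw [hu, add_sub_cancel_right]; rfl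
  have hw' : (conicCover hC.sig₁ hM e (θ + rho l₁ l₂ l₃ ν) : ℝ × ℝ)
      = projMap M (circlePoint e (u + w)) := by
    have : u + w = 4 * ellK e * (θ + rho l₁ l₂ l₃ ν) := by
      rw [hu, hrho]; field_simp; ring
    rw [this]; rfl
  have hMu := hM.isUnit_det
  -- Validity makes ν₁ + l₃ν₂ positive and smaller than the other two coefficients, so the inner
  -- ellipse lies in the unit disk, where the projective map is controlled.
  have hdisk : ∀ q : ℝ × ℝ, (ν.1 + l₁ * ν.2) * q.1 ^ 2 + (ν.1 + l₂ * ν.2) * q.2 ^ 2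
      = ν.1 + l₃ * ν.2 → q.1 ^ 2 + q.2 ^ 2 ≤ 1 := by
    intro q hq
    have h1 : (ν.1 + l₃ * ν.2) * (q.1 ^ 2 + q.2 ^ 2) ≤ (ν.1 + l₃ * ν.2) * 1 := by
      nlinarith [mul_nonneg (mul_pos (sub_pos.2 hl2) hν2).le (sq_nonneg q.2),
        mul_nonneg (mul_pos (sub_pos.2 (hl2.trans hl1)) hν2).le (sq_nonneg q.1)]
    exact le_of_mul_le_mul_left h1 pc
  have hp : (ν.1 + l₁ * ν.2) * (tangencyPoint e u w).1 ^ 2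
      + (ν.1 + l₂ * ν.2) * (tangencyPoint e u w).2 ^ 2 = ν.1 + l₃ * ν.2 := by
    have h1 := jacobiCn_sq u e
    simp only [tangencyPoint]
    rw [← hdsq, ← hcsq]
    field_simp
    linarith
  have hpd := projDenom_ne_zero hC.sig₁ hM.diag₁ hMu (hdisk _ hp)
  rw [hz, hw']
  refine ⟨projMap M (tangencyPoint e u w), ?_, ?_, ?_⟩
  · have h := quad_projMap (C := pencil C₁ C₂ ν) hpd
    rw [hM.pencil, quad_diagonal] at h
    simp only [Matrix.cons_val] at h
    have h0 : projDenom M (tangencyPoint e u w) ^ 2 * quad (pencil C₁ C₂ ν)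
        ![(projMap M (tangencyPoint e u w)).1, (projMap M (tangencyPoint e u w)).2, 1] = 0 := by
      rw [← h]; linarith
    exact (mul_eq_zero.1 h0).resolve_left (pow_ne_zero 2 hpd)
  · obtain ⟨t, ht0, ht1, h1, h2⟩ := tangencyPoint_mem_chord he0 he1 u w
    exact projMap_mem_segment hC.sig₁ hM.diag₁ hMu (circlePoint_mem e _).le
      (circlePoint_mem e _).le ht0 ht1 h1 h2
  · intro q hq hne
    obtain ⟨p, hpq, rfl⟩ := exists_projMap_eq hMu pa pb (hM.pencil ν) hq
    refine orient_projMap_pos hC.sig₁ hM.diag₁ hM.orientation (circlePoint_mem e _).le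
      (circlePoint_mem e _).le (hdisk p hpq) (orient_tangent_pos he0 he1 u hsn hcn ?_ ?_)
    · refine mul_left_cancel₀ pa.ne' ?_
      linear_combination hpq + p.2 ^ 2 * hdsq - hcsq
    · rintro rfl
      exact hne rfl

/-- Through a point outside `Ci` there is at most one positively tangent chord. -/
theorem IsPositiveCover.positivelyTangent_unique {C Ci : Set (ℝ × ℝ)} {c : ℝ → C}
    (hc : IsPositiveCover c) (hdisj : ∀ p ∈ Ci, p ∉ C) {z w w' : C}
    (h : PositivelyTangent Ci z w) (h' : PositivelyTangent Ci z w') : w = w' := by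
  obtain ⟨p, hp, hseg, hpos⟩ := h
  obtain ⟨p', hp', hseg', hpos'⟩ := h'
  rw [segment_eq_image'] at hseg hseg'
  obtain ⟨s, ⟨hs0, -⟩, hs⟩ := hseg
  obtain ⟨s', ⟨hs0', -⟩, hs'⟩ := hseg'
  have hs1 : 0 < s := by
    refine lt_of_le_of_ne hs0 ?_
    rintro rfl
    simp only [zero_smul, add_zero] at hs
    exact hdisj p hp (hs ▸ z.2)
  have hs1' : 0 < s' := by
    refine lt_of_le_of_ne hs0' ?_
    rintro rfl
    simp only [zero_smul, add_zero] at hs'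
    exact hdisj p' hp' (hs' ▸ z.2)
  have hwz : w ≠ z := by
    rintro rfl
    simp only [sub_self, smul_zero, add_zero] at hs
    exact hdisj p hp (hs ▸ w.2)
  have hwz' : w' ≠ z := by
    rintro rfl
    simp only [sub_self, smul_zero, add_zero] at hs'
    exact hdisj p' hp' (hs' ▸ w'.2)
  have hline : ∀ (a b d : ℝ × ℝ) (t : ℝ), orient a b (a + t • (d - a)) = t * orient a b d := by
    intro a b d t
    simp only [orient, Prod.fst_add, Prod.snd_add, Prod.smul_fst, Prod.smul_snd, Prod.fst_sub,
      Prod.snd_sub, smul_eq_mul]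
    ring
  have hself : ∀ a b : ℝ × ℝ, orient a b b = 0 := fun a b => by simp only [orient]; ring
  -- The contact point p' lies weakly left of zw, and w' lies on the ray from z through p' because
  -- s' > 0; so w' is weakly left of zw. By symmetry w is weakly left of zw', hence z, w, w' are
  -- collinear.
  have hge : 0 ≤ orient z w p' := by
    rcases eq_or_ne p' p with h | h
    · rw [h, ← hs, hline, hself, mul_zero]
    · exact (hpos p' hp' h).le
  have hge' : 0 ≤ orient z w' p := by
    rcases eq_or_ne p p' with h | h
    · rw [h, ← hs', hline, hself, mul_zero]
    · exact (hpos' p hp h).le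
  rw [← hs', hline] at hge
  rw [← hs, hline, orient_swap] at hge'
  have h1 := nonneg_of_mul_nonneg_right hge hs1'
  have h2 := nonneg_of_mul_nonneg_right hge' hs1
  exact hc.eq_of_orient_eq_zero hwz hwz' (by linarith)

/-- The rotation by r supplies a tangent chord at every point; uniqueness of that chord upgrades
this to the equivalence that defines the Poncelet map. -/
theorem IsPositiveCover.exists_isPonceletMap {C Ci : Set (ℝ × ℝ)} {c : ℝ → C}
    (hc : IsPositiveCover c) (hdisj : ∀ p ∈ Ci, p ∉ C) {r : ℝ}
    (h : ∀ θ, PositivelyTangent Ci (c θ) (c (θ + r))) : ∃ P : C ≃ₜ C, IsPonceletMap C Ci P := by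
  obtain ⟨P, hP⟩ := hc.exists_rotation r
  refine ⟨P, fun z w => ?_⟩
  obtain ⟨θ, rfl⟩ := hc.surjective z
  rw [hP]
  refine ⟨fun hw => hc.positivelyTangent_unique hdisj hw (h θ), ?_⟩
  rintro rfl
  exact h θ

theorem isPonceletMap_ponceletMap {C Ci : Set (ℝ × ℝ)} (h : ∃ P : C ≃ₜ C, IsPonceletMap C Ci P) :
    IsPonceletMap C Ci (ponceletMap C Ci) := by
  rw [ponceletMap, dif_pos h]
  exact h.choose_spec

theorem StandingAssumptions.isPonceletMap_pencilMap (hC : StandingAssumptions C₁ C₂ l₁ l₂ l₃)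
    (hM : IsDiagonalizer C₁ C₂ l₁ l₂ l₃ M) {ν : ℝ × ℝ} (hν : Valid l₃ ν) :
    IsPonceletMap (conic C₁) (conic (pencil C₁ C₂ ν)) (pencilMap C₁ C₂ ν) :=
  isPonceletMap_ponceletMap <|
    (isPositiveCover_conicCover hC.sig₁ hM (eccentricity_nonneg l₁ l₂ l₃)
      (eccentricity_lt_one hC.lt₁₂ hC.lt₂₃)).exists_isPonceletMap
      (fun _ hp => hC.notMem_conic hν hp) (hC.positivelyTangent hM hν)

theorem StandingAssumptions.pencilMap_conicCover (hC : StandingAssumptions C₁ C₂ l₁ l₂ l₃)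
    (hM : IsDiagonalizer C₁ C₂ l₁ l₂ l₃ M) {ν : ℝ × ℝ} (hν : Valid l₃ ν) (θ : ℝ) :
    pencilMap C₁ C₂ ν (conicCover hC.sig₁ hM (eccentricity l₁ l₂ l₃) θ) =
      conicCover hC.sig₁ hM (eccentricity l₁ l₂ l₃) (θ + rho l₁ l₂ l₃ ν) :=
  ((hC.isPonceletMap_pencilMap hM hν _ _).1 (hC.positivelyTangent hM hν θ)).symm

theorem StandingAssumptions.pencilComposition_conicCover
    (hC : StandingAssumptions C₁ C₂ l₁ l₂ l₃) (hM : IsDiagonalizer C₁ C₂ l₁ l₂ l₃ M) {N : ℕ}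
    {ν : Fin N → ℝ × ℝ} (k : Fin N → ℤ) (hν : ∀ j, Valid l₃ (ν j)) (θ : ℝ) :
    pencilComposition C₁ C₂ ν k (conicCover hC.sig₁ hM (eccentricity l₁ l₂ l₃) θ) =
      conicCover hC.sig₁ hM (eccentricity l₁ l₂ l₃)
        (θ + ∑ j, (k j : ℝ) * rho l₁ l₂ l₃ (ν j)) :=
  reverse_prod_ofFn_lift
    (fun j => zpow_lift (hC.pencilMap_conicCover hM (hν j)) (k j)) θ

end Standard

end Poncelet

end

theorem mainTheorem3 (C₁ C₂ : Matrix (Fin 3) (Fin 3) ℝ) (l₁ l₂ l₃ : ℝ)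
    (hC : Poncelet.StandingAssumptions C₁ C₂ l₁ l₂ l₃) :
    -- the Poncelet maps of the pencil are well defined homeomorphisms
    (∀ ν : ℝ × ℝ, Poncelet.Valid l₃ ν →
      Poncelet.IsPonceletMap (Poncelet.conic C₁)
        (Poncelet.conic (Poncelet.pencil C₁ C₂ ν)) (Poncelet.pencilMap C₁ C₂ ν)) ∧
    -- there is a diagonalizing matrix, and each one gives a common covering map
    (∃ M : Matrix (Fin 3) (Fin 3) ℝ, Poncelet.IsDiagonalizer C₁ C₂ l₁ l₂ l₃ M) ∧
    (∀ M : Matrix (Fin 3) (Fin 3) ℝ, Poncelet.IsDiagonalizer C₁ C₂ l₁ l₂ l₃ M →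
      ∃ Cov : ℝ → Poncelet.conic C₁,
        (∀ θ : ℝ, (Cov θ : ℝ × ℝ) =
          Poncelet.standardCover M (Poncelet.eccentricity l₁ l₂ l₃) θ) ∧
        Poncelet.IsPositiveCover Cov ∧
        (∀ ν : ℝ × ℝ, Poncelet.Valid l₃ ν → ∀ θ : ℝ,
          Poncelet.pencilMap C₁ C₂ ν (Cov θ) = Cov (θ + Poncelet.rho l₁ l₂ l₃ ν)) ∧
        (∀ ν μ : ℝ × ℝ, Poncelet.Valid l₃ ν → Poncelet.Valid l₃ μ → ∀ θ : ℝ,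
          Poncelet.pencilMap C₁ C₂ ν (Poncelet.pencilMap C₁ C₂ μ (Cov θ)) =
            Cov (θ + (Poncelet.rho l₁ l₂ l₃ μ + Poncelet.rho l₁ l₂ l₃ ν))) ∧
        (∀ (N : ℕ) (ν : Fin N → ℝ × ℝ) (k : Fin N → ℤ), (∀ j, Poncelet.Valid l₃ (ν j)) →
          ∀ θ : ℝ, Poncelet.pencilComposition C₁ C₂ ν k (Cov θ) =
            Cov (θ + ∑ j, (k j : ℝ) * Poncelet.rho l₁ l₂ l₃ (ν j)))) ∧
    -- the Poncelet maps commute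
    (∀ ν μ : ℝ × ℝ, Poncelet.Valid l₃ ν → Poncelet.Valid l₃ μ → ∀ z : Poncelet.conic C₁,
      Poncelet.pencilMap C₁ C₂ ν (Poncelet.pencilMap C₁ C₂ μ z) =
        Poncelet.pencilMap C₁ C₂ μ (Poncelet.pencilMap C₁ C₂ ν z)) ∧
    -- rotation number of a composition (it is defined modulo 1), and the closure criterion
    (∀ (N : ℕ) (ν : Fin N → ℝ × ℝ) (k : Fin N → ℤ), (∀ j, Poncelet.Valid l₃ (ν j)) →
      (∀ r : ℝ, Poncelet.HasRotationNumber (Poncelet.pencilComposition C₁ C₂ ν k) r ↔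
        ∃ m : ℤ, r = ∑ j, (k j : ℝ) * Poncelet.rho l₁ l₂ l₃ (ν j) + m) ∧
      List.TFAE [
        ∀ z : Poncelet.conic C₁, Poncelet.pencilComposition C₁ C₂ ν k z = z,
        ∃ m : ℤ, ∑ j, (k j : ℝ) * Poncelet.rho l₁ l₂ l₃ (ν j) = m,
        ∃ z : Poncelet.conic C₁, Poncelet.pencilComposition C₁ C₂ ν k z = z]) := by
  have he0 := Poncelet.eccentricity_nonneg l₁ l₂ l₃
  have he1 := Poncelet.eccentricity_lt_one hC.lt₁₂ hC.lt₂₃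
  obtain ⟨M₀, hM₀⟩ := hC.exists_isDiagonalizer
  have hcov := Poncelet.isPositiveCover_conicCover hC.sig₁ hM₀ he0 he1
  refine ⟨fun ν hν => hC.isPonceletMap_pencilMap hM₀ hν, ⟨M₀, hM₀⟩, fun M hM => ?_,
    fun ν μ hν hμ z => ?_, fun N ν k hν => ?_⟩
  · refine ⟨Poncelet.conicCover hC.sig₁ hM (Poncelet.eccentricity l₁ l₂ l₃), fun θ => rfl,
      Poncelet.isPositiveCover_conicCover hC.sig₁ hM he0 he1,
      fun ν hν => hC.pencilMap_conicCover hM hν, fun ν μ hν hμ θ => ?_,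
      fun N ν k hν => hC.pencilComposition_conicCover hM k hν⟩
    rw [hC.pencilMap_conicCover hM hμ, hC.pencilMap_conicCover hM hν, add_assoc]
  · obtain ⟨θ, rfl⟩ := hcov.surjective z
    rw [hC.pencilMap_conicCover hM₀ hμ, hC.pencilMap_conicCover hM₀ hν,
      hC.pencilMap_conicCover hM₀ hν, hC.pencilMap_conicCover hM₀ hμ, add_right_comm]
  · have hlift := hC.pencilComposition_conicCover hM₀ k hν
    exact ⟨hcov.hasRotationNumber_iff hlift, hcov.tfae_of_lift hlift⟩
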